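/- Let $N\ge 1$ and let $f\in L^2(\mathbb{R}^N)$ be real-valued, not almost everywhere zero, with $\|\mathbf{x}\|_2 f\in L^2(\mathbb{R}^N)$ and $\|\mathbf{w}\|_2\,\mathcal{F}f\in L^2(\mathbb{R}^N)$, where $\mathcal{F}f(\mathbf{w})=\int f(\mathbf{x})e^{-2\pi i\langle \mathbf{x},\mathbf{w}\rangle}\,d\mathbf{x}$ (in the sense of Plancherel), and assume that the gradient $\nabla f$ exists at every point of $\mathbb{R}^N$. Let $\phi:\mathbb{R}^N\times\mathbb{R}^N\to\mathbb{C}$ be a kernel with $|\phi|=1$, such that $\phi(\mathbf{v},2(\mathbf{z}-\mathbf{t}))$ depends on $\mathbf{t}$ only, and which is real-valued, $\phi=\pm1$. Let $\mathrm{C}f$ be the Cohen's class time-frequency distribution of $f$ with kernel $\phi$, formally $$\mathrm{C}f(\mathbf{x},\mathbf{w})=\iint f\Big(\mathbf{z}+\frac{\mathbf{y}}{2}\Big)\overline{f\Big(\mathbf{z}-\frac{\mathbf{y}}{2}\Big)}\Big(\int\phi(\mathbf{v},\mathbf{y})e^{-2\pi i\langle\mathbf{v},\mathbf{x}-\mathbf{z}\rangle}\,d\mathbf{v}\Big)e^{-2\pi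 i\langle\mathbf{y},\mathbf{w}\rangle}\,d\mathbf{z}\,d\mathbf{y},$$ that is, the Fourier transform, in $L^2(\mathbb{R}^{2N})$ and from $(\mathbf{v},\mathbf{y})$ to $(\mathbf{x},\mathbf{w})$, of $\phi(\mathbf{v},\mathbf{y})\int f(\mathbf{z}+\frac{\mathbf{y}}{2})\overline{f(\mathbf{z}-\frac{\mathbf{y}}{2})}e^{2\pi i\langle\mathbf{z},\mathbf{v}\rangle}\,d\mathbf{z}$. Define $$\mathbf{x}^0_{\mathrm{C}}=\frac{\iint\mathbf{x}\,|\mathrm{C}f|^2\,d\mathbf{x}\,d\mathbf{w}}{\iint|\mathrm{C}f|^2\,d\mathbf{x}\,d\mathbf{w}},\quad \mathbf{w}^0_{\mathrm{C}}=\frac{\iint\mathbf{w}\,|\mathrm{C}f|^2\,d\mathbf{x}\,d\mathbf{w}}{\iint|\mathrm{C}f|^2\,d\mathbf{x}\,d\mathbf{w}},$$ $$\Delta\mathbf{x}^2_{\mathrm{C},f}=\frac{\iint\|\mathbf{x}-\mathbf{x}^0_{\mathrm{C}}\|_2^2\,|\mathrm{C}f|^2\,d\mathbf{x}\,d\mathbf{w}}{\iint|\mathrm{C}f|^2\,d\mathbf{x}\,d\mathbf{w}},\quad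 \Delta\mathbf{w}^2_{\mathrm{C},f}=\frac{\iint\|\mathbf{w}-\mathbf{w}^0_{\mathrm{C}}\|_2^2\,|\mathrm{C}f|^2\,d\mathbf{x}\,d\mathbf{w}}{\iint|\mathrm{C}f|^2\,d\mathbf{x}\,d\mathbf{w}}.$$ Then $$\Delta\mathbf{x}^2_{\mathrm{C},f}\,\Delta\mathbf{w}^2_{\mathrm{C},f}\ \ge\ \frac{\mathfrak{B}^{\mathrm R}}{4}=\frac{N^2}{64\pi^2},\qquad \mathfrak{B}^{\mathrm R}=\frac{N^2}{16\pi^2}.$$ When $f$ is nonzero almost everywhere, equality holds if and only if $f$ or $-f$ is an optimal Gaussian function, where a function $g$ is called an optimal Gaussian function if there are $\zeta>0$ and $\epsilon\in\mathbb{R}$ such that $g(\mathbf{x})=e^{-\frac{1}{2\zeta}\|\mathbf{x}-\mathbf{x}_g^0\|_2^2+\epsilon}$ for all $\mathbf{x}$, with $\mathbf{x}_g^0=\int\mathbf{x}\,|g|^2\,d\mathbf{x}\big/\int|g|^2\,d\mathbf{x}$. -/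

import Mathlib

open MeasureTheory
open scoped FourierTransform ComplexConjugate

namespace CohenClass

noncomputable section

/-- The Euclidean space `ℝ^N`. -/
abbrev Space (N : ℕ) : Type := EuclideanSpace ℝ (Fin N)

/-- The time-frequency space `ℝ^N × ℝ^N` with its Euclidean structure and Lebesgue measure. -/
abbrev Phase (N : ℕ) : Type := WithLp 2 (Space N × Space N)

/-- The Fourier transform, with kernel `e^{-2πi⟨x, w⟩}`, of a square integrable function on a
finite-dimensional Euclidean space, in the sense of Plancherel's theorem (a representative of an
`L²` class). The value is the zero function if `g` is not square integrable. -/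
def l2Fourier {V : Type*} [NormedAddCommGroup V] [InnerProductSpace ℝ V] [FiniteDimensional ℝ V]
    [MeasurableSpace V] [BorelSpace V] (g : V → ℂ) : V → ℂ :=
  open Classical in
  if h : MemLp g 2 (volume : Measure V) then
    ((𝓕 (h.toLp g : Lp (α := V) ℂ 2) : Lp (α := V) ℂ 2) : V → ℂ)
  else 0

/-- The tensor product `f ⊗ conj f` after the change of coordinates:
`(z, y) ↦ f (z + y/2) * conj (f (z - y/2))`. -/
def shiftedTensor {N : ℕ} (f : Space N → ℂ) (z y : Space N) : ℂ :=
  f (z + (1 / 2 : ℝ) • y) * conj (f (z - (1 / 2 : ℝ) • y))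

/-- The ambiguity function `A(v, y) = ∫ f (z + y/2) * conj (f (z - y/2)) * e^{2πi⟨z, v⟩} dz`,
the inverse partial Fourier transform of `shiftedTensor f` in its first variable. The integral
converges absolutely for all `v` and `y` when `f` is square integrable. -/
def ambiguity {N : ℕ} (f : Space N → ℂ) (v y : Space N) : ℂ :=
  𝓕⁻ (fun z : Space N => shiftedTensor f z y) v

/-- Cohen's class time-frequency distribution of `f` with kernel `φ`. Formally
`Cf(x, w) = ∬ f (z + y/2) conj (f (z - y/2)) (∫ φ(v, y) e^{-2πi⟨v, x - z⟩} dv) e^{-2πi⟨y, w⟩} dz dy`.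
For a bounded kernel the innermost integral exists only as a tempered distribution; the pairing
in `z` is a convolution with that distribution, which is carried out on the Fourier side: the
`z`-integral turns the shifted tensor product into the ambiguity function, this is multiplied by
`φ`, and the remaining partial Fourier transforms in `v` and in `y` together form the Fourier
transform from `(v, y)` to `(x, w)`, that is
`Cf(x, w) = ∬ φ(v, y) A(v, y) e^{-2πi(⟨v, x⟩ + ⟨y, w⟩)} dv dy`.
For `f` square integrable and `φ` bounded and measurable, `φ * A` is square integrable, and this is
its Plancherel transform. -/
def cctfd {N : ℕ} (φ : Space N → Space N → ℂ) (f : Space N → ℂ) : Phase N → ℂ :=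
  l2Fourier (fun p : Phase N => φ p.fst p.snd * ambiguity f p.fst p.snd)

/-- The kernel is of unit modulus and is `v`-independent and invariant under time translation,
reversal and scaling: `|φ| = 1` and `φ(v, 2(z - t))` is a function of `t` alone. -/
structure IsUMITRSK {N : ℕ} (φ : Space N → Space N → ℂ) : Prop where
  unit_modulus : ∀ v y, ‖φ v y‖ = 1
  invariant : ∃ ψ : Space N → ℂ, ∀ v z t, φ v ((2 : ℝ) • (z - t)) = ψ t

/-- The moment vector in the time variable of a function on the time-frequency space:
`⟨x C, C⟩ / ‖C‖²`. -/
def timeMomentTF {N : ℕ} (C : Phase N → ℂ) : Space N :=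
  (∫ p, ‖C p‖ ^ 2)⁻¹ • ∫ p, ‖C p‖ ^ 2 • p.fst

/-- The moment vector in the frequency variable of a function on the time-frequency space:
`⟨w C, C⟩ / ‖C‖²`. -/
def freqMomentTF {N : ℕ} (C : Phase N → ℂ) : Space N :=
  (∫ p, ‖C p‖ ^ 2)⁻¹ • ∫ p, ‖C p‖ ^ 2 • p.snd

/-- The spread in the time variable: `‖(x - x⁰) C‖² / ‖C‖²`, with `x⁰` the moment vector. -/
def timeSpreadTF {N : ℕ} (C : Phase N → ℂ) : ℝ :=
  (∫ p, ‖p.fst - timeMomentTF C‖ ^ 2 * ‖C p‖ ^ 2) / ∫ p, ‖C p‖ ^ 2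

/-- The spread in the frequency variable: `‖(w - w⁰) C‖² / ‖C‖²`, with `w⁰` the moment vector. -/
def freqSpreadTF {N : ℕ} (C : Phase N → ℂ) : ℝ :=
  (∫ p, ‖p.snd - freqMomentTF C‖ ^ 2 * ‖C p‖ ^ 2) / ∫ p, ‖C p‖ ^ 2

/-- The moment vector in the time domain of a real-valued function: `⟨x f, f⟩ / ‖f‖²`. -/
def timeMoment {N : ℕ} (f : Space N → ℝ) : Space N :=
  (∫ x, f x ^ 2)⁻¹ • ∫ x, f x ^ 2 • x

/-- `f(x) = e^{-‖x - x⁰‖² / (2ζ) + ε}` for some `ζ > 0` and real `ε`, where `x⁰` is the moment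
vector of `f`. -/
def IsOptimalGaussian {N : ℕ} (f : Space N → ℝ) : Prop :=
  ∃ ζ ε : ℝ, 0 < ζ ∧
    ∀ x, f x = Real.exp (-(1 / (2 * ζ)) * ‖x - timeMoment f‖ ^ 2 + ε)

/-- The lower bound `N² / (16π²)` on the uncertainty product of real-valued functions. -/
def realBound (N : ℕ) : ℝ := (N : ℝ) ^ 2 / (16 * Real.pi ^ 2)

end

end CohenClass

/-! The invariance of the kernel forces it to be a unimodular constant, so the energy density of the
distribution is that of the Fourier transform of the ambiguity function. The characteristic function
of such a density is an autocorrelation. Shifting the ambiguity function in `v` alone and applying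
Parseval in that variable turns the autocorrelation into the characteristic function of the midpoint
of two independent points with density `|f|²`. Hence the time marginal is `midpointLaw (energy f)`.
A quarter turn of phase space exchanges `f` with its Fourier transform and gives the frequency
marginal (`map_fst_energy_cctfd`, `map_snd_energy_cctfd`). Averaging two independent copies halves
the variance, so each spread is half the corresponding spread of `f` or of its transform
(`spreads_cctfd_const`), and the product is a quarter of the Heisenberg product. For real `f` the
transform has even energy, hence frequency mean zero.

The Heisenberg inequality is proved with difference quotients, so no Sobolev regularity of `f` is
needed in advance. The squared `L²` norms of `defect`, summed over coordinates, are bounded by a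
quadratic in `λ` plus an error vanishing with the step (`sum_integral_defect_sq_le`). Nonnegativity
of the quadratic gives the bound through its discriminant. In the equality case, with `N > 0`, the
quadratic has a root `λ > 0`. There the defect tends to zero in `L²`, so weakly `∂ᵢf = -λ(xᵢ -
cᵢ)f`, and the integrating factor `gaussWeight` makes `f` almost everywhere a Gaussian
(`exists_ae_eq_gaussian`). Partial derivatives existing everywhere make this an identity at every
point (`eq_gaussian_of_ae_eq`). The converse is a computation of Gaussian moments. -/

namespace CohenClass

/-! ### Characters and the Plancherel transform -/

section Fourier

open Complex Real Filter Topology SchwartzMap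
open scoped ContDiff RealInnerProductSpace

variable {V : Type*} [NormedAddCommGroup V] [InnerProductSpace ℝ V]

/-- The character `w ↦ e^{2πi⟨h, w⟩}`. -/
noncomputable def character (h w : V) : ℂ := cexp (↑(2 * π * ⟪h, w⟫) * I)

lemma norm_character (h w : V) : ‖character h w‖ = 1 := norm_exp_ofReal_mul_I _

lemma character_add_left (h k w : V) :
    character (h + k) w = character h w * character k w := by
  simp only [character, inner_add_left, ← Complex.exp_add]
  congr 1; push_cast; ring

lemma character_add_right (h w u : V) :
    character h (w + u) = character h w * character h u := by
  simp only [character, inner_add_right, ← Complex.exp_add]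
  congr 1; push_cast; ring

lemma conj_character (h w : V) : conj (character h w) = character (-h) w := by
  simp only [character, ← Complex.exp_conj]
  congr 1
  rw [map_mul, Complex.conj_ofReal, Complex.conj_I, inner_neg_left]
  push_cast; ring

lemma character_comm (h w : V) : character h w = character w h := by
  simp only [character, real_inner_comm]

@[simp] lemma character_zero_left (w : V) : character 0 w = 1 := by simp [character]

lemma character_neg_mul_self (h w : V) : character (-h) w * character h w = 1 := by
  rw [← character_add_left]; simp

@[fun_prop] lemma contDiff_character (h : V) : ContDiff ℝ ∞ (character h) := by
  unfold character
  have : ContDiff ℝ ∞ fun w : V => ((2 * π * ⟪h, w⟫ : ℝ) : ℂ) :=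
    Complex.ofRealCLM.contDiff.comp (contDiff_const.mul (contDiff_const.inner ℝ contDiff_id))
  fun_prop

@[fun_prop] lemma continuous_character (h : V) : Continuous (character h) :=
  (contDiff_character h).continuous

lemma continuous_character_prod : Continuous fun p : V × V => character p.1 p.2 := by
  unfold character; fun_prop

variable [FiniteDimensional ℝ V] [MeasurableSpace V] [BorelSpace V]

lemma fourier_eq_integral_character (f : V → ℂ) (w : V) :
    𝓕 f w = ∫ v, character (-w) v * f v := by
  rw [Real.fourier_eq']
  refine integral_congr_ae (Eventually.of_forall fun v => ?_)
  simp only [character, smul_eq_mul, inner_neg_left, real_inner_comm]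
  congr 3; push_cast; ring

lemma fourierInv_eq_integral_character (f : V → ℂ) (w : V) :
    𝓕⁻ f w = ∫ v, character w v * f v := by
  rw [Real.fourierInv_eq_fourier_neg, fourier_eq_integral_character, neg_neg]

lemma fourier_comp_add (f : V → ℂ) (h w : V) :
    𝓕 (fun x => f (x + h)) w = character h w * 𝓕 f w := by
  rw [fourier_eq_integral_character, fourier_eq_integral_character,
    ← integral_add_right_eq_self (fun v => character (-w) v * f v) h, ← integral_const_mul]
  refine integral_congr_ae (Eventually.of_forall fun v => ?_)
  simp only [character_add_right]
  rw [show character h w = character w h from character_comm _ _]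
  linear_combination (-character (-w) v * f (v + h)) * character_neg_mul_self w h

lemma fourier_character_mul (f : V → ℂ) (h w : V) :
    𝓕 (fun x => character h x * f x) w = 𝓕 f (w - h) := by
  rw [fourier_eq_integral_character, fourier_eq_integral_character]
  refine integral_congr_ae (Eventually.of_forall fun v => ?_)
  simp only [show -(w - h) = -w + h by abel, character_add_left]; ring

lemma memLp_character_mul {f : V → ℂ} (hf : MemLp f 2) (h : V) :
    MemLp (fun x => character h x * f x) 2 := by
  refine hf.of_le ((continuous_character h).aestronglyMeasurable.mul hf.1)
    (Eventually.of_forall fun x => ?_)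
  simp [norm_character]

lemma memLp_comp_add {E : Type*} [NormedAddCommGroup E] {f : V → E} (hf : MemLp f 2) (h : V) :
    MemLp (fun x => f (x + h)) 2 :=
  hf.comp_measurePreserving (measurePreserving_add_right volume h)

lemma l2Fourier_of_memLp {f : V → ℂ} (hf : MemLp f 2) :
    l2Fourier f = ((𝓕 (hf.toLp f : Lp (α := V) ℂ 2) : Lp (α := V) ℂ 2) : V → ℂ) :=
  dif_pos hf

lemma memLp_l2Fourier (f : V → ℂ) : MemLp (l2Fourier f) 2 := by
  unfold l2Fourier
  split_ifs
  · exact Lp.memLp _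
  · exact MemLp.zero'

lemma stronglyMeasurable_l2Fourier (f : V → ℂ) : StronglyMeasurable (l2Fourier f) := by
  unfold l2Fourier
  split_ifs
  · exact Lp.stronglyMeasurable _
  · exact stronglyMeasurable_zero

lemma l2Fourier_congr {f g : V → ℂ} (h : f =ᵐ[volume] g) : l2Fourier f = l2Fourier g := by
  by_cases hf : MemLp f 2
  · have hg : MemLp g 2 := hf.ae_eq h
    rw [l2Fourier_of_memLp hf, l2Fourier_of_memLp hg, (MemLp.toLp_eq_toLp_iff hf hg).2 h]
  · have hg : ¬ MemLp g 2 := fun hg => hf (hg.ae_eq h.symm)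
    simp [l2Fourier, hf, hg]

/-- Parseval's identity. -/
lemma integral_conj_l2Fourier_mul {f g : V → ℂ} (hf : MemLp f 2) (hg : MemLp g 2) :
    ∫ w, conj (l2Fourier f w) * l2Fourier g w = ∫ x, conj (f x) * g x := by
  have := Lp.inner_fourier_eq (hf.toLp f : Lp (α := V) ℂ 2) (hg.toLp g)
  rw [L2.inner_def, L2.inner_def, ← l2Fourier_of_memLp hf, ← l2Fourier_of_memLp hg] at this
  simp only [RCLike.inner_apply'] at this
  rw [this]
  refine integral_congr_ae ?_
  filter_upwards [hf.coeFn_toLp, hg.coeFn_toLp] with x h1 h2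
  rw [h1, h2]

/-- Characterises the Plancherel transform by duality with test functions; the transform rules below
are verified against such `g`. -/
lemma integral_test_mul_l2Fourier {f g : V → ℂ} (hf : MemLp f 2) (hg : ContDiff ℝ ∞ g)
    (hgc : HasCompactSupport g) :
    ∫ w, g w * l2Fourier f w = ∫ x, 𝓕 g x * f x := by
  have := congrArg (fun T => T (hgc.toSchwartzMap hg))
    (Lp.fourier_toTemperedDistribution_eq (hf.toLp f : Lp (α := V) ℂ 2))
  simp only [TemperedDistribution.fourier_apply, Lp.toTemperedDistribution_apply,
    ← l2Fourier_of_memLp hf, SchwartzMap.fourier_coe, smul_eq_mul] at this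
  have hc : ((hgc.toSchwartzMap hg : 𝓢(V, ℂ)) : V → ℂ) = g := rfl
  rw [hc] at this
  rw [← this]
  refine integral_congr_ae ?_
  filter_upwards [hf.coeFn_toLp] with x h1
  rw [h1]

lemma ae_eq_of_forall_integral_test_mul_eq {f g : V → ℂ} (hf : LocallyIntegrable f)
    (hg : LocallyIntegrable g)
    (h : ∀ u : V → ℂ, ContDiff ℝ ∞ u → HasCompactSupport u → ∫ x, u x * f x = ∫ x, u x * g x) :
    f =ᵐ[volume] g := by
  refine ae_eq_of_integral_contDiff_smul_eq hf hg fun u hu huc => ?_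
  simpa only [real_smul] using h (fun x => (u x : ℂ)) (Complex.ofRealCLM.contDiff.comp hu)
    (huc.comp_left (g := fun r : ℝ => (r : ℂ)) ofReal_zero)

lemma locallyIntegrable_of_memLp_two {E : Type*} [NormedAddCommGroup E] {f : V → E}
    (hf : MemLp f 2) : LocallyIntegrable f :=
  hf.locallyIntegrable (by norm_num)

lemma integrable_of_contDiff_of_hasCompactSupport {g : V → ℂ} (hg : ContDiff ℝ ∞ g)
    (hgc : HasCompactSupport g) : Integrable g :=
  hg.continuous.integrable_of_hasCompactSupport hgc

lemma l2Fourier_ae_eq_fourier {f : V → ℂ} (hf : MemLp f 2) (hf1 : Integrable f) :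
    l2Fourier f =ᵐ[volume] 𝓕 f := by
  refine ae_eq_of_forall_integral_test_mul_eq (locallyIntegrable_of_memLp_two (memLp_l2Fourier f)) ?_
    fun u hu huc => ?_
  · exact (VectorFourier.fourierIntegral_continuous Real.continuous_fourierChar
      (by exact continuous_inner) hf1).locallyIntegrable
  · rw [integral_test_mul_l2Fourier hf hu huc]
    have := VectorFourier.integral_fourierIntegral_smul_eq_flip (μ := (volume : Measure V))
      (ν := (volume : Measure V)) (L := innerₗ V) Real.continuous_fourierChar
      (by exact continuous_inner) (integrable_of_contDiff_of_hasCompactSupport hu huc) hf1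
    simp only [smul_eq_mul, flip_innerₗ] at this
    exact this

lemma l2Fourier_comp_add {f : V → ℂ} (hf : MemLp f 2) (h : V) :
    l2Fourier (fun x => f (x + h)) =ᵐ[volume] fun w => character h w * l2Fourier f w := by
  refine ae_eq_of_forall_integral_test_mul_eq (locallyIntegrable_of_memLp_two (memLp_l2Fourier _))
    (locallyIntegrable_of_memLp_two (memLp_character_mul (memLp_l2Fourier f) h)) fun u hu huc => ?_
  rw [integral_test_mul_l2Fourier (memLp_comp_add hf h) hu huc]
  have h2 := integral_test_mul_l2Fourier hf (g := fun w => character h w * u w)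
    (by fun_prop) huc.mul_left
  have h3 : ∀ w, u w * (character h w * l2Fourier f w)
    = character h w * u w * l2Fourier f w := fun w => by ring
  simp_rw [h3, h2, fourier_character_mul]
  rw [← integral_add_right_eq_self (fun x => 𝓕 u (x - h) * f x) h]
  simp

lemma l2Fourier_character_mul {f : V → ℂ} (hf : MemLp f 2) (h : V) :
    l2Fourier (fun x => character h x * f x) =ᵐ[volume] fun w => l2Fourier f (w - h) := by
  have hm : MemLp (fun w => l2Fourier f (w - h)) 2 := by
    simpa [sub_eq_add_neg] using memLp_comp_add (memLp_l2Fourier f) (-h)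
  refine ae_eq_of_forall_integral_test_mul_eq (locallyIntegrable_of_memLp_two (memLp_l2Fourier _))
    (locallyIntegrable_of_memLp_two hm) fun u hu huc => ?_
  rw [integral_test_mul_l2Fourier (memLp_character_mul hf h) hu huc]
  have h2 := integral_test_mul_l2Fourier hf (g := fun w => u (w + h))
    (by fun_prop) (huc.comp_homeomorph (Homeomorph.addRight h))
  simp_rw [fourier_comp_add] at h2
  rw [← integral_add_right_eq_self (fun w => u w * l2Fourier f (w - h)) h]
  simp only [add_sub_cancel_right]
  rw [h2]
  refine integral_congr_ae (Eventually.of_forall fun x => ?_)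
  ring

lemma l2Fourier_const_mul {f : V → ℂ} (hf : MemLp f 2) (c : ℂ) :
    l2Fourier (fun x => c * f x) =ᵐ[volume] fun w => c * l2Fourier f w := by
  refine ae_eq_of_forall_integral_test_mul_eq (locallyIntegrable_of_memLp_two (memLp_l2Fourier _))
    (locallyIntegrable_of_memLp_two ((memLp_l2Fourier f).const_mul c)) fun u hu huc => ?_
  rw [integral_test_mul_l2Fourier (hf.const_mul c) hu huc]
  have h3 : ∀ w, u w * (c * l2Fourier f w) = c * (u w * l2Fourier f w) := fun w => by ring
  have h4 : ∀ w, 𝓕 u w * (c * f w) = c * (𝓕 u w * f w) := fun w => by ring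
  simp_rw [h3, h4, integral_const_mul, integral_test_mul_l2Fourier hf hu huc]

lemma integral_conj_fourierInv_mul {f g : V → ℂ} (hf : MemLp f 2) (hg : MemLp g 2)
    (hf1 : Integrable f) (hg1 : Integrable g) :
    ∫ w, conj (𝓕⁻ f w) * 𝓕⁻ g w = ∫ x, conj (f x) * g x := by
  rw [← integral_conj_l2Fourier_mul hf hg]
  simp_rw [Real.fourierInv_eq_fourier_neg]
  rw [integral_neg_eq_self (fun w => conj (𝓕 f w) * 𝓕 g w)]
  refine integral_congr_ae ?_
  filter_upwards [l2Fourier_ae_eq_fourier hf hf1, l2Fourier_ae_eq_fourier hg hg1] with x h1 h2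
  rw [h1, h2]

end Fourier

/-! ### Measures with density `‖g‖²` -/

section Energy

open scoped ENNReal

variable {α : Type*} [MeasureSpace α]

/-- The measure with density `‖g‖²`. -/
noncomputable def energy (g : α → ℂ) : Measure α := volume.withDensity fun x => ‖g x‖ₑ ^ 2

lemma aemeasurable_enorm_sq {g : α → ℂ} (hg : MemLp g 2) :
    AEMeasurable (fun x => ‖g x‖ₑ ^ 2) volume := hg.1.enorm.pow_const 2

lemma enorm_sq_toReal (z : ℂ) : (‖z‖ₑ ^ 2).toReal = ‖z‖ ^ 2 := by simp

lemma integral_energy {E : Type*} [NormedAddCommGroup E] [NormedSpace ℝ E] {g : α → ℂ}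
    (hg : MemLp g 2) (F : α → E) : ∫ x, F x ∂(energy g) = ∫ x, ‖g x‖ ^ 2 • F x := by
  rw [energy, integral_withDensity_eq_integral_toReal_smul₀ (aemeasurable_enorm_sq hg)
    (ae_of_all _ fun x => by simp)]
  simp only [enorm_sq_toReal]

lemma integrable_energy_iff {E : Type*} [NormedAddCommGroup E] [NormedSpace ℝ E] {g : α → ℂ}
    (hg : MemLp g 2) (F : α → E) :
    Integrable F (energy g) ↔ Integrable (fun x => ‖g x‖ ^ 2 • F x) := by
  rw [energy, integrable_withDensity_iff_integrable_smul₀' (aemeasurable_enorm_sq hg)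
    (ae_of_all _ fun x => by simp)]
  simp only [enorm_sq_toReal]

lemma isFiniteMeasure_energy {g : α → ℂ} (hg : MemLp g 2) : IsFiniteMeasure (energy g) := by
  refine isFiniteMeasure_withDensity (ne_of_lt ?_)
  have := hg.integrable_norm_pow (by norm_num)
  have h2 := this.2
  simpa [hasFiniteIntegral_iff_enorm] using h2

end Energy

/-! ### The ambiguity function -/

section Ambiguity

open Complex Real Filter Topology
open scoped ContDiff RealInnerProductSpace

variable {N : ℕ}

lemma measurePreserving_shear :
    MeasurePreserving
      (fun q : Space N × Space N => (q.1 + (1 / 2 : ℝ) • q.2, q.1 - (1 / 2 : ℝ) • q.2))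
      (volume.prod volume) (volume.prod volume) := by
  have h1 : MeasurePreserving (fun q : Space N × Space N => (q.2, q.1 + (1 / 2 : ℝ) • q.2))
      (volume.prod volume) (volume.prod volume) := by
    have := (MeasurePreserving.id (volume : Measure (Space N))).skew_product
      (g := fun y z : Space N => z + (1 / 2 : ℝ) • y) (μc := volume) (μd := volume)
      (by simp only [Function.uncurry_def]; fun_prop)
      (Eventually.of_forall fun y => map_add_right_eq_self volume _)
    exact this.comp Measure.measurePreserving_swap
  have h2 : MeasurePreserving (fun q : Space N × Space N => (q.1, q.1 - q.2))
      (volume.prod volume) (volume.prod volume) :=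
    (MeasurePreserving.id (volume : Measure (Space N))).skew_product
      (g := fun y z : Space N => y - z) (μc := volume) (μd := volume)
      (by simp only [Function.uncurry_def]; fun_prop)
      (Eventually.of_forall fun y => (Measure.measurePreserving_sub_left volume y).map_eq)
  -- The map factors as `(z, y) ↦ (y, z + y/2) ↦ (z + y/2, y) ↦ (z + y/2, z - y/2)`: two skew
  -- translations and a swap.
  have := h2.comp (Measure.measurePreserving_swap.comp h1)
  convert this using 2 with q
  simp only [Function.comp, Prod.swap, Prod.mk.injEq, true_and]
  module

variable {f : Space N → ℂ}

lemma memLp_tensor (hf : MemLp f 2) :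
    MemLp (fun q : Space N × Space N => f q.1 * conj (f q.2)) 2 (volume.prod volume) := by
  have hm : AEStronglyMeasurable (fun q : Space N × Space N => f q.1 * conj (f q.2))
      (volume.prod volume) :=
    hf.1.comp_fst.mul (continuous_conj.comp_aestronglyMeasurable hf.1.comp_snd)
  rw [memLp_two_iff_integrable_sq_norm hm]
  have := (hf.integrable_norm_pow (by norm_num)).mul_prod (hf.integrable_norm_pow (by norm_num))
  simpa [mul_pow] using this

lemma memLp_shiftedTensor (hf : MemLp f 2) :
    MemLp (fun q : Space N × Space N => shiftedTensor f q.1 q.2) 2 (volume.prod volume) :=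
  (memLp_tensor hf).comp_measurePreserving measurePreserving_shear

lemma memLp_conj {α : Type*} {m : MeasurableSpace α} {μ : Measure α} {f : α → ℂ}
    (hf : MemLp f 2 μ) : MemLp (fun x => conj (f x)) 2 μ :=
  hf.of_le (continuous_conj.comp_aestronglyMeasurable hf.1) (ae_of_all _ fun x => by simp)

lemma integrable_shiftedTensor (hf : MemLp f 2) (y : Space N) :
    Integrable fun z => shiftedTensor f z y := by
  have h1 := memLp_comp_add hf ((1 / 2 : ℝ) • y)
  have h2 := memLp_conj (memLp_comp_add hf (-((1 / 2 : ℝ) • y)))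
  refine (h1.integrable_mul h2).congr (ae_of_all _ fun z => ?_)
  simp [shiftedTensor, sub_eq_add_neg]

/-- A product of two `L²` functions is only `L¹` in general; Fubini supplies square integrability of
almost every section, which is what Plancherel in `z` requires. -/
lemma ae_memLp_shiftedTensor (hf : MemLp f 2) :
    ∀ᵐ y : Space N, MemLp (fun z => shiftedTensor f z y) 2 := by
  have h := ((memLp_shiftedTensor hf).integrable_norm_pow (by norm_num)).prod_left_ae
  filter_upwards [h] with y hy
  exact (memLp_two_iff_integrable_sq_norm (integrable_shiftedTensor hf y).1).2 hy

lemma stronglyMeasurable_ambiguity (hf : StronglyMeasurable f) :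
    StronglyMeasurable fun q : Space N × Space N => ambiguity f q.1 q.2 := by
  simp only [ambiguity, fourierInv_eq_integral_character]
  refine StronglyMeasurable.integral_prod_right
    (f := fun (q : Space N × Space N) z => character q.1 z * shiftedTensor f z q.2) ?_
  unfold shiftedTensor
  refine StronglyMeasurable.mul ?_ (StronglyMeasurable.mul ?_ ?_)
  · exact (continuous_character_prod.comp
      (by fun_prop : Continuous fun p : (Space N × Space N) × Space N =>
        (p.1.1, p.2))).stronglyMeasurable
  · exact hf.comp_measurable (by fun_prop)
  · exact continuous_conj.comp_stronglyMeasurable (hf.comp_measurable (by fun_prop))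

lemma ambiguity_add_left (v a y : Space N) :
    ambiguity f (v + a) y = 𝓕⁻ (fun z => character a z * shiftedTensor f z y) v := by
  simp only [ambiguity, fourierInv_eq_integral_character, character_add_left, mul_assoc]

lemma memLp_fourierInv {g : Space N → ℂ} (hg : MemLp g 2) (hg1 : Integrable g) :
    MemLp (𝓕⁻ g) 2 := by
  have h1 : MemLp (𝓕 g) 2 := (memLp_l2Fourier g).ae_eq (l2Fourier_ae_eq_fourier hg hg1)
  exact (h1.comp_measurePreserving (Measure.measurePreserving_neg volume)).ae_eq
    (ae_of_all _ fun w => (Real.fourierInv_eq_fourier_neg g w).symm)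

lemma integral_norm_sq_fourierInv {g : Space N → ℂ} (hg : MemLp g 2) (hg1 : Integrable g) :
    ∫ w, ‖𝓕⁻ g w‖ ^ 2 = ∫ x, ‖g x‖ ^ 2 := by
  have := integral_conj_fourierInv_mul hg hg hg1 hg1
  simp only [Complex.conj_mul'] at this
  exact_mod_cast this

/-- Plancherel in the first variable for almost every `y`, then Tonelli. -/
lemma memLp_ambiguity (hfm : StronglyMeasurable f) (hf : MemLp f 2) :
    MemLp (fun q : Space N × Space N => ambiguity f q.1 q.2) 2 (volume.prod volume) := by
  have hm := (stronglyMeasurable_ambiguity hfm).aestronglyMeasurable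
    (μ := (volume : Measure (Space N)).prod (volume : Measure (Space N)))
  have hm2 : AEStronglyMeasurable (fun q : Space N × Space N => ‖ambiguity f q.1 q.2‖ ^ 2)
      (volume.prod volume) := hm.norm.pow 2
  have hT := (memLp_shiftedTensor hf).integrable_norm_pow (p := 2) (by norm_num)
  rw [memLp_two_iff_integrable_sq_norm hm, integrable_prod_iff' hm2]
  refine ⟨?_, (hT.integral_norm_prod_right).congr ?_⟩
  · filter_upwards [ae_memLp_shiftedTensor hf] with y hy
    exact (memLp_fourierInv hy (integrable_shiftedTensor hf y)).integrable_norm_pow (by norm_num)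
  · filter_upwards [ae_memLp_shiftedTensor hf] with y hy
    simp only [norm_pow, norm_norm, ambiguity]
    exact (integral_norm_sq_fourierInv hy (integrable_shiftedTensor hf y)).symm

lemma integrable_character_mul_norm_sq_shiftedTensor (hf : MemLp f 2) (a : Space N) :
    Integrable (fun q : Space N × Space N =>
      character a q.1 * ((‖shiftedTensor f q.1 q.2‖ ^ 2 : ℝ) : ℂ)) (volume.prod volume) := by
  have h := ((memLp_shiftedTensor hf).integrable_norm_pow (p := 2) (by norm_num)).ofReal (𝕜 := ℂ)
  refine h.mono ((((continuous_character a).comp continuous_fst).aestronglyMeasurable).mul h.1)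
    (ae_of_all _ fun q => ?_)
  rw [norm_mul, norm_character, one_mul]
  exact le_rfl

lemma integral_character_mul_norm_sq_shiftedTensor (hfm : StronglyMeasurable f) (a : Space N) :
    ∫ q : Space N × Space N, character a q.1 * ((‖shiftedTensor f q.1 q.2‖ ^ 2 : ℝ) : ℂ)
        ∂(volume.prod volume) =
      ∫ q : Space N × Space N, character a ((1 / 2 : ℝ) • (q.1 + q.2)) *
        ((‖f q.1‖ ^ 2 * ‖f q.2‖ ^ 2 : ℝ) : ℂ) ∂(volume.prod volume) := by
  have hmeas : AEStronglyMeasurable (fun q : Space N × Space N =>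
      character a ((1 / 2 : ℝ) • (q.1 + q.2)) * ((‖f q.1‖ ^ 2 * ‖f q.2‖ ^ 2 : ℝ) : ℂ))
      (volume.prod volume) := by
    have : StronglyMeasurable fun q : Space N × Space N =>
        ((‖f q.1‖ ^ 2 * ‖f q.2‖ ^ 2 : ℝ) : ℂ) :=
      Complex.continuous_ofReal.comp_stronglyMeasurable
        (((hfm.comp_measurable measurable_fst).norm.pow 2).mul
          ((hfm.comp_measurable measurable_snd).norm.pow 2))
    exact (((continuous_character a).comp (by fun_prop :
      Continuous fun q : Space N × Space N =>
        (1 / 2 : ℝ) • (q.1 + q.2))).aestronglyMeasurable).mul this.aestronglyMeasurable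
  rw [← measurePreserving_shear.map_eq] at hmeas
  conv_rhs => rw [← measurePreserving_shear.map_eq]
  rw [integral_map measurePreserving_shear.measurable.aemeasurable hmeas]
  refine integral_congr_ae (ae_of_all _ fun q => ?_)
  have e : (1 / 2 : ℝ) • (q.1 + (1 / 2 : ℝ) • q.2 + (q.1 - (1 / 2 : ℝ) • q.2)) = q.1 := by module
  simp only [e, shiftedTensor, norm_mul, RCLike.norm_conj, mul_pow]

/-- A shift in `v` is a modulation in `z`, so Parseval leaves the character against the squared
modulus. -/
lemma integral_conj_ambiguity_mul_add_section {y : Space N} (hf : MemLp f 2)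
    (hy : MemLp (fun z => shiftedTensor f z y) 2) (a : Space N) :
    ∫ v, conj (ambiguity f v y) * ambiguity f (v + a) y =
      ∫ z, character a z * ((‖shiftedTensor f z y‖ ^ 2 : ℝ) : ℂ) := by
  have hy1 := integrable_shiftedTensor hf y
  have hc1 : Integrable fun z => character a z * shiftedTensor f z y := by
    refine hy1.mono ((continuous_character a).aestronglyMeasurable.mul hy1.1)
      (ae_of_all _ fun q => ?_)
    rw [norm_mul, norm_character, one_mul]
  simp only [ambiguity_add_left]
  simp only [ambiguity]
  rw [integral_conj_fourierInv_mul hy (memLp_character_mul hy a) hy1 hc1]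
  refine integral_congr_ae (ae_of_all _ fun z => ?_)
  simp only [ofReal_pow, ← Complex.conj_mul']
  ring

lemma integral_conj_ambiguity_mul_add (hfm : StronglyMeasurable f) (hf : MemLp f 2)
    (a : Space N) :
    ∫ q : Space N × Space N, conj (ambiguity f q.1 q.2) * ambiguity f (q.1 + a) q.2
        ∂(volume.prod volume) =
      ∫ q : Space N × Space N, character a ((1 / 2 : ℝ) • (q.1 + q.2)) *
        ((‖f q.1‖ ^ 2 * ‖f q.2‖ ^ 2 : ℝ) : ℂ) ∂(volume.prod volume) := by
  have hA := memLp_ambiguity hfm hf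
  have hs : MeasurePreserving (fun q : Space N × Space N => (q.1 + a, q.2))
      (volume.prod volume) (volume.prod volume) :=
    (measurePreserving_add_right volume a).prod (MeasurePreserving.id volume)
  have hA' : MemLp (fun q : Space N × Space N => ambiguity f (q.1 + a) q.2) 2
      (volume.prod volume) := (hA.comp_measurePreserving hs :)
  have hAc : MemLp (fun q : Space N × Space N => conj (ambiguity f q.1 q.2)) 2
      (volume.prod volume) := memLp_conj hA
  have hint : Integrable (fun q : Space N × Space N =>
      conj (ambiguity f q.1 q.2) * ambiguity f (q.1 + a) q.2) (volume.prod volume) :=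
    hAc.integrable_mul hA'
  rw [integral_prod_symm _ hint, ← integral_character_mul_norm_sq_shiftedTensor hfm,
    integral_prod_symm _ (integrable_character_mul_norm_sq_shiftedTensor hf a)]
  refine integral_congr_ae ?_
  filter_upwards [ae_memLp_shiftedTensor hf] with y hy
  exact integral_conj_ambiguity_mul_add_section hf hy a

/-- The ambiguity functions of `f` and of its Fourier transform differ by a quarter turn of the
phase space. -/
lemma ambiguity_eq_ambiguity_l2Fourier (hf : MemLp f 2) (v y : Space N) :
    ambiguity f v y = ambiguity (l2Fourier f) y (-v) := by
  set k : Space N := (1 / 2 : ℝ) • y with hk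
  have h1 := memLp_comp_add hf k
  have h2 := memLp_comp_add hf (-k)
  have h3 := memLp_character_mul h1 v
  have key := integral_conj_l2Fourier_mul h2 h3
  simp only [ambiguity, fourierInv_eq_integral_character]
  have e1 : ∫ z, character v z * shiftedTensor f z y =
      ∫ x, conj (f (x + -k)) * (character v x * f (x + k)) := by
    refine integral_congr_ae (ae_of_all _ fun z => ?_)
    simp only [shiftedTensor, ← hk, sub_eq_add_neg]; ring
  have hs : (fun w => l2Fourier (fun x => f (x + k)) (w - v)) =ᵐ[volume]
      fun w => character k (w - v) * l2Fourier f (w - v) :=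
    (measurePreserving_sub_right volume v).quasiMeasurePreserving.ae_eq (l2Fourier_comp_add hf k)
  -- Parseval pairs the transform at `w - v` with its conjugate at `w`; translating by `v/2` centres
  -- this pair, as `shiftedTensor` requires.
  rw [e1, ← key, ← integral_add_right_eq_self
    (fun w => character y w * shiftedTensor (l2Fourier f) w (-v)) (-((1 / 2 : ℝ) • v))]
  refine integral_congr_ae ?_
  filter_upwards [l2Fourier_comp_add hf (-k), l2Fourier_character_mul h1 v, hs] with w a1 a2 a3
  rw [a1, a2, a3, map_mul, conj_character, neg_neg, shiftedTensor]
  have e2 : w + -((1 / 2 : ℝ) • v) + (1 / 2 : ℝ) • (-v) = w - v := by module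
  have e3 : w + -((1 / 2 : ℝ) • v) - (1 / 2 : ℝ) • (-v) = w := by module
  have e4 : character y (w + -((1 / 2 : ℝ) • v)) = character k w * character k (w - v) := by
    rw [← character_add_right, hk]
    simp only [character, inner_add_right, inner_sub_right, inner_neg_right, inner_smul_right,
      real_inner_smul_left]
    congr 2; push_cast; ring
  rw [e2, e3, e4]; ring

end Ambiguity

/-! ### Marginals of the energy as midpoint laws -/

section Marginals

open Complex Real Filter Topology
open scoped ContDiff RealInnerProductSpace ENNReal

/-- The distribution of the midpoint of two independent points with law `ν`. -/
noncomputable def midpointLaw {N : ℕ} (ν : Measure (Space N)) : Measure (Space N) :=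
  (ν.prod ν).map fun q => (1 / 2 : ℝ) • (q.1 + q.2)

variable {N : ℕ}

instance (ν : Measure (Space N)) [IsFiniteMeasure ν] : IsFiniteMeasure (midpointLaw ν) := by
  unfold midpointLaw; infer_instance

/-- Converts between the normalisation `e^{2πi⟨·,·⟩}` of the Fourier transform and `e^{i⟨·,·⟩}` of
`charFun`. -/
lemma character_inv_two_pi_smul {V : Type*} [NormedAddCommGroup V] [InnerProductSpace ℝ V]
    (t x : V) : character ((2 * π)⁻¹ • t) x = cexp (⟪x, t⟫ * I) := by
  rw [character, real_inner_smul_left, ← mul_assoc, mul_inv_cancel₀ (by positivity), one_mul,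
    real_inner_comm]

lemma charFun_energy {V : Type*} [NormedAddCommGroup V] [InnerProductSpace ℝ V]
    [FiniteDimensional ℝ V] [MeasurableSpace V] [BorelSpace V] {g : V → ℂ} (hg : MemLp g 2)
    (t : V) : charFun (energy g) t = ∫ x, conj (g x) * (character ((2 * π)⁻¹ • t) x * g x) := by
  rw [charFun_apply, integral_energy hg]
  refine integral_congr_ae (ae_of_all _ fun x => ?_)
  simp only [character_inv_two_pi_smul, real_smul, ofReal_pow, ← Complex.conj_mul']
  ring

lemma charFun_midpointLaw {f : Space N → ℂ} (hf : MemLp f 2) (t : Space N) :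
    charFun (midpointLaw (energy f)) t =
      ∫ q : Space N × Space N, character ((2 * π)⁻¹ • t) ((1 / 2 : ℝ) • (q.1 + q.2)) *
        ((‖f q.1‖ ^ 2 * ‖f q.2‖ ^ 2 : ℝ) : ℂ) ∂(volume.prod volume) := by
  have hm := aemeasurable_enorm_sq hf
  have hm2 : AEMeasurable (fun q : Space N × Space N => ‖f q.1‖ₑ ^ 2 * ‖f q.2‖ₑ ^ 2)
      (volume.prod volume) := hm.comp_fst.mul hm.comp_snd
  rw [charFun_apply, midpointLaw, integral_map (by fun_prop) (by fun_prop), energy,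
    prod_withDensity₀ hm hm, integral_withDensity_eq_integral_toReal_smul₀
      hm2 (ae_of_all _ fun x => ?_)]
  · refine integral_congr_ae (ae_of_all _ fun q => ?_)
    simp only [character_inv_two_pi_smul, ENNReal.toReal_mul, enorm_sq_toReal, real_smul]
    ring
  · exact ENNReal.mul_lt_top (by simp) (by simp)

lemma measurePreserving_fst_snd :
    MeasurePreserving (fun p : Phase N => (p.fst, p.snd)) volume (volume.prod volume) :=
  WithLp.volume_preserving_ofLp (Space N) (Space N)

lemma memLp_phase {B : Space N × Space N → ℂ} (hB : MemLp B 2 (volume.prod volume)) :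
    MemLp (fun p : Phase N => B (p.fst, p.snd)) 2 :=
  (hB.comp_measurePreserving measurePreserving_fst_snd :)

lemma integral_phase {E : Type*} [NormedAddCommGroup E] [NormedSpace ℝ E]
    (F : Space N × Space N → E) :
    ∫ p : Phase N, F (p.fst, p.snd) = ∫ q, F q ∂(volume.prod volume) :=
  measurePreserving_fst_snd.integral_comp
    (MeasurableEquiv.toLp 2 (Space N × Space N)).symm.measurableEmbedding F

/-- The characteristic function of the energy of a Fourier transform is an autocorrelation. -/
lemma charFun_energy_l2Fourier {V : Type*} [NormedAddCommGroup V] [InnerProductSpace ℝ V]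
    [FiniteDimensional ℝ V] [MeasurableSpace V] [BorelSpace V] {g : V → ℂ} (hg : MemLp g 2)
    (t : V) :
    charFun (energy (l2Fourier g)) t = ∫ x, conj (g x) * g (x + (2 * π)⁻¹ • t) := by
  rw [charFun_energy (memLp_l2Fourier g), ← integral_conj_l2Fourier_mul hg (memLp_comp_add hg _)]
  refine integral_congr_ae ?_
  filter_upwards [l2Fourier_comp_add hg ((2 * π)⁻¹ • t)] with w hw
  rw [hw]

lemma charFun_map_fst {μ : Measure (Phase N)} (t : Space N) :
    charFun (μ.map fun p => p.fst) t = charFun μ (WithLp.toLp 2 (t, 0)) := by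
  rw [charFun_apply, charFun_apply, integral_map (by fun_prop) (by fun_prop)]
  simp

lemma charFun_map_snd {μ : Measure (Phase N)} (t : Space N) :
    charFun (μ.map fun p => p.snd) t = charFun μ (WithLp.toLp 2 (0, t)) := by
  rw [charFun_apply, charFun_apply, integral_map (by fun_prop) (by fun_prop)]
  simp

variable {f : Space N → ℂ}

/-- The unimodular constant cancels in the autocorrelation, so the energy does not depend on it. -/
lemma charFun_energy_cctfd (hfm : StronglyMeasurable f) (hf : MemLp f 2) {c : ℂ}
    (hc : conj c * c = 1) (s t : Space N) :
    charFun (energy (cctfd (fun _ _ => c) f)) (WithLp.toLp 2 (s, t)) =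
      ∫ q : Space N × Space N, conj (ambiguity f q.1 q.2) *
        ambiguity f (q.1 + (2 * π)⁻¹ • s) (q.2 + (2 * π)⁻¹ • t) ∂(volume.prod volume) := by
  have hB : MemLp (fun p : Phase N => c * ambiguity f p.fst p.snd) 2 :=
    (memLp_phase (memLp_ambiguity hfm hf)).const_mul c
  rw [cctfd, charFun_energy_l2Fourier hB, ← integral_phase]
  refine integral_congr_ae (ae_of_all _ fun p => ?_)
  simp only [WithLp.add_fst, WithLp.add_snd, WithLp.smul_fst, WithLp.smul_snd, map_mul]
  change conj c * conj (ambiguity f p.fst p.snd) *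
    (c * ambiguity f (p.fst + (2 * π)⁻¹ • s) (p.snd + (2 * π)⁻¹ • t)) = _
  linear_combination (conj (ambiguity f p.fst p.snd) *
        ambiguity f (p.fst + (2 * π)⁻¹ • s) (p.snd + (2 * π)⁻¹ • t)) * hc

lemma memLp_cctfd (φ : Space N → Space N → ℂ) (f : Space N → ℂ) : MemLp (cctfd φ f) 2 :=
  memLp_l2Fourier _

lemma map_fst_energy_cctfd (hfm : StronglyMeasurable f) (hf : MemLp f 2) {c : ℂ}
    (hc : conj c * c = 1) :
    (energy (cctfd (fun _ _ => c) f)).map (fun p => p.fst) = midpointLaw (energy f) := by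
  have := isFiniteMeasure_energy (memLp_cctfd (fun _ _ => c) f)
  have := isFiniteMeasure_energy hf
  refine Measure.ext_of_charFun (funext fun t => ?_)
  rw [charFun_map_fst, charFun_energy_cctfd hfm hf hc, charFun_midpointLaw hf,
    ← integral_conj_ambiguity_mul_add hfm hf]
  simp

lemma map_snd_energy_cctfd (hfm : StronglyMeasurable f) (hf : MemLp f 2) {c : ℂ}
    (hc : conj c * c = 1) :
    (energy (cctfd (fun _ _ => c) f)).map (fun p => p.snd) =
      midpointLaw (energy (l2Fourier f)) := by
  have := isFiniteMeasure_energy (memLp_cctfd (fun _ _ => c) f)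
  have := isFiniteMeasure_energy (memLp_l2Fourier f)
  refine Measure.ext_of_charFun (funext fun t => ?_)
  have hs := stronglyMeasurable_ambiguity (stronglyMeasurable_l2Fourier f)
  rw [charFun_map_snd, charFun_energy_cctfd hfm hf hc, charFun_midpointLaw (memLp_l2Fourier f),
    ← integral_conj_ambiguity_mul_add (stronglyMeasurable_l2Fourier f) (memLp_l2Fourier f)]
  -- The quarter turn matching the ambiguity functions of `f` and of its transform; it carries a
  -- shift in `y` to a shift in the first variable.
  have hp : MeasurePreserving (fun q : Space N × Space N => (q.2, -q.1)) (volume.prod volume)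
      (volume.prod volume) :=
    ((MeasurePreserving.id volume).prod (Measure.measurePreserving_neg volume)).comp
      Measure.measurePreserving_swap
  conv_rhs => rw [← hp.map_eq]
  rw [integral_map hp.measurable.aemeasurable]
  · simp [ambiguity_eq_ambiguity_l2Fourier hf]
  · exact ((continuous_conj.comp_stronglyMeasurable hs).mul
      (hs.comp_measurable (by fun_prop :
        Measurable fun q : Space N × Space N =>
          (q.1 + (2 * π)⁻¹ • t, q.2)))).aestronglyMeasurable

end Marginals

/-! ### Barycentre and variance of the midpoint law -/

section Moments

open Real Filter Topology
open scoped ENNReal RealInnerProductSpace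

variable {N : ℕ}

/-- The barycentre of a finite measure. -/
noncomputable def barycentre (ν : Measure (Space N)) : Space N :=
  (ν.real Set.univ)⁻¹ • ∫ x, x ∂ν

/-- The second moment of a measure about its barycentre. -/
noncomputable def centralMoment (ν : Measure (Space N)) : ℝ :=
  ∫ x, ‖x - barycentre ν‖ ^ 2 ∂ν

variable {ν : Measure (Space N)} [IsFiniteMeasure ν]

lemma midpointLaw_real_univ : (midpointLaw ν).real Set.univ = ν.real Set.univ ^ 2 := by
  rw [midpointLaw, measureReal_def, Measure.map_apply (by fun_prop) MeasurableSet.univ,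
    Set.preimage_univ, ← Set.univ_prod_univ, Measure.prod_prod, ENNReal.toReal_mul, sq,
    measureReal_def]

lemma integrable_id_of_memLp (hν : MemLp id 2 ν) : Integrable (fun x => x) ν :=
  hν.integrable (by norm_num)

lemma barycentre_midpointLaw (h0 : ν.real Set.univ ≠ 0) (hν : MemLp id 2 ν) :
    barycentre (midpointLaw ν) = barycentre ν := by
  have hi := integrable_id_of_memLp hν
  rw [barycentre, barycentre, midpointLaw_real_univ, midpointLaw,
    integral_map (by fun_prop) (by fun_prop), integral_smul,
    integral_add (hi.comp_fst ν) (hi.comp_snd ν), integral_fun_fst (fun x : Space N => x),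
    integral_fun_snd (fun x : Space N => x),
    ← two_smul ℝ, smul_smul, smul_smul, smul_smul]
  congr 1
  field_simp

lemma integral_sub_barycentre (h0 : ν.real Set.univ ≠ 0) (hν : MemLp id 2 ν) :
    ∫ x, (x - barycentre ν) ∂ν = 0 := by
  rw [integral_sub (integrable_id_of_memLp hν) (integrable_const _), integral_const, barycentre,
    smul_smul, mul_inv_cancel₀ h0, one_smul, sub_self]

/-- By independence the cross term integrates to zero. Each of the two square terms contributes a
quarter of the central moment times the mass of the other factor. -/
lemma centralMoment_midpointLaw (h0 : ν.real Set.univ ≠ 0) (hν : MemLp id 2 ν) :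
    centralMoment (midpointLaw ν) = ν.real Set.univ / 2 * centralMoment ν := by
  have hsub : MemLp (fun x => x - barycentre ν) 2 ν := hν.sub (memLp_const _)
  have hsq : Integrable (fun x => ‖x - barycentre ν‖ ^ 2) ν :=
    hsub.integrable_norm_pow (by norm_num)
  have hi : Integrable (fun x => x - barycentre ν) ν := hsub.integrable (by norm_num)
  rw [centralMoment, barycentre_midpointLaw h0 hν, midpointLaw,
    integral_map (by fun_prop) (by fun_prop)]
  have hcross : Integrable (fun q : Space N × Space N =>
      ⟪q.1 - barycentre ν, q.2 - barycentre ν⟫) (ν.prod ν) := by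
    refine (hi.norm.mul_prod hi.norm).mono (by fun_prop) (ae_of_all _ fun q => ?_)
    simpa using abs_real_inner_le_norm (q.1 - barycentre ν) (q.2 - barycentre ν)
  have hexp : ∀ q : Space N × Space N, ‖(1 / 2 : ℝ) • (q.1 + q.2) - barycentre ν‖ ^ 2 =
      (1 / 4) * ‖q.1 - barycentre ν‖ ^ 2 + (1 / 4) * ‖q.2 - barycentre ν‖ ^ 2 +
        (1 / 2) * ⟪q.1 - barycentre ν, q.2 - barycentre ν⟫ := fun q => by
    have : (1 / 2 : ℝ) • (q.1 + q.2) - barycentre ν =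
        (1 / 2 : ℝ) • ((q.1 - barycentre ν) + (q.2 - barycentre ν)) := by module
    rw [this, norm_smul, mul_pow, norm_add_sq_real, Real.norm_eq_abs, sq_abs]
    ring
  have h1 : Integrable (fun q : Space N × Space N => 1 / 4 * ‖q.1 - barycentre ν‖ ^ 2)
      (ν.prod ν) := (hsq.comp_fst ν).const_mul (1 / 4)
  have h2 : Integrable (fun q : Space N × Space N => 1 / 4 * ‖q.2 - barycentre ν‖ ^ 2)
      (ν.prod ν) := (hsq.comp_snd ν).const_mul (1 / 4)
  have h12 : Integrable (fun q : Space N × Space N => 1 / 4 * ‖q.1 - barycentre ν‖ ^ 2 +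
      1 / 4 * ‖q.2 - barycentre ν‖ ^ 2) (ν.prod ν) := h1.add h2
  have hz : ∫ q : Space N × Space N, ⟪q.1 - barycentre ν, q.2 - barycentre ν⟫ ∂(ν.prod ν) = 0 := by
    rw [integral_prod _ hcross]
    simp only
    have : ∀ x : Space N, ∫ y, ⟪x - barycentre ν, y - barycentre ν⟫ ∂ν = 0 := fun x => by
      rw [integral_inner hi, integral_sub_barycentre h0 hν, inner_zero_right]
    simp [this]
  simp_rw [hexp]
  rw [integral_add h12 (hcross.const_mul _), integral_add h1 h2]
  simp only [integral_const_mul]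
  rw [hz, integral_fun_fst (fun x : Space N => ‖x - barycentre ν‖ ^ 2),
    integral_fun_snd (fun x : Space N => ‖x - barycentre ν‖ ^ 2), centralMoment]
  simp only [smul_eq_mul]
  ring

end Moments

/-! ### From marginals to spreads -/

section Spreads

open Real

variable {N : ℕ} {C : Phase N → ℂ} {ν : Measure (Space N)} [IsFiniteMeasure ν]

lemma energy_real_univ {α : Type*} [MeasureSpace α] {g : α → ℂ} (hg : MemLp g 2) :
    (energy g).real Set.univ = ∫ x, ‖g x‖ ^ 2 := by
  have := integral_energy hg (fun _ => (1 : ℝ))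
  simpa using this

lemma map_real_univ {α β : Type*} [MeasurableSpace α] [MeasurableSpace β] {μ : Measure α}
    {X : α → β} (hX : Measurable X) : (μ.map X).real Set.univ = μ.real Set.univ := by
  rw [measureReal_def, Measure.map_apply hX MeasurableSet.univ, Set.preimage_univ, measureReal_def]

/-- Stated for a general `X` so as to serve both the time and the frequency projection. -/
lemma spread_of_map_energy_eq (hC : MemLp C 2) {X : Phase N → Space N} (hX : Measurable X)
    (hν : MemLp id 2 ν) (h0 : ν.real Set.univ ≠ 0) (h : (energy C).map X = midpointLaw ν) :
    (∫ p, ‖X p - (∫ p, ‖C p‖ ^ 2)⁻¹ • ∫ p, ‖C p‖ ^ 2 • X p‖ ^ 2 * ‖C p‖ ^ 2) / ∫ p, ‖C p‖ ^ 2 =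
      centralMoment ν / (2 * ν.real Set.univ) := by
  have hm : ∫ p, ‖C p‖ ^ 2 = ν.real Set.univ ^ 2 := by
    rw [← energy_real_univ hC, ← map_real_univ hX, h, midpointLaw_real_univ]
  have hb : (∫ p, ‖C p‖ ^ 2)⁻¹ • ∫ p, ‖C p‖ ^ 2 • X p = barycentre (midpointLaw ν) := by
    rw [barycentre, midpointLaw_real_univ, ← hm, ← h, integral_map hX.aemeasurable (by fun_prop),
      integral_energy hC]
  have hv : ∫ p, ‖X p - barycentre (midpointLaw ν)‖ ^ 2 * ‖C p‖ ^ 2 =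
      centralMoment (midpointLaw ν) := by
    rw [centralMoment]
    conv_rhs => rw [← h]
    rw [integral_map hX.aemeasurable (by fun_prop), integral_energy hC, h]
    simp only [smul_eq_mul, mul_comm]
  rw [hb, hv, hm, centralMoment_midpointLaw h0 hν]
  field_simp

lemma memLp_id_energy {g : Space N → ℂ} (hg : MemLp g 2)
    (hxg : Integrable fun x => ‖x‖ ^ 2 * ‖g x‖ ^ 2) : MemLp id 2 (energy g) := by
  rw [memLp_two_iff_integrable_sq_norm (by fun_prop), integrable_energy_iff hg]
  simpa [mul_comm] using hxg

end Spreads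

/-! ### Vanishing weak gradient -/

section WeakGradient

open Filter Topology Convolution
open scoped ContDiff

/-- The hypothesis applied to the reflected translate `y ↦ φ (x - y)`: it says that mollifications
of `g` have zero derivative. -/
lemma integral_comp_sub_mul_fderiv {V : Type*} [NormedAddCommGroup V] [InnerProductSpace ℝ V]
    [FiniteDimensional ℝ V] [MeasurableSpace V] [BorelSpace V] {g : V → ℝ}
    (h : ∀ χ : V → ℝ, ContDiff ℝ ∞ χ → HasCompactSupport χ → ∀ v,
      ∫ x, g x * fderiv ℝ χ x v = 0) {φ : V → ℝ} (hφ : ContDiff ℝ ∞ φ)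
    (hφc : HasCompactSupport φ) (x v : V) : ∫ t, fderiv ℝ φ t v * g (x - t) = 0 := by
  have h1 := h (fun y => φ (x - y)) (by fun_prop)
    (hφc.comp_homeomorph (Homeomorph.subLeft x)) v
  have h2 : ∀ y, fderiv ℝ (fun y => φ (x - y)) y v = -fderiv ℝ φ (x - y) v := fun y => by
    have hd : HasFDerivAt (fun y => φ (x - y))
        ((fderiv ℝ φ (x - y)).comp (-ContinuousLinearMap.id ℝ V)) y := by
      refine HasFDerivAt.comp y ?_ ?_
      · exact (hφ.differentiable (by simp) (x - y)).hasFDerivAt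
      · exact (hasFDerivAt_id y).const_sub x
    rw [hd.fderiv]; simp
  simp only [h2, mul_neg, integral_neg, neg_eq_zero] at h1
  rw [← integral_sub_left_eq_self (fun t => fderiv ℝ φ t v * g (x - t)) volume x]
  simpa [mul_comm] using h1

/-- A locally integrable function with vanishing weak gradient is almost everywhere constant. -/
lemma exists_ae_eq_const_of_weak_gradient_eq_zero {V : Type*} [NormedAddCommGroup V]
    [InnerProductSpace ℝ V] [FiniteDimensional ℝ V] [MeasurableSpace V] [BorelSpace V] {g : V → ℝ}
    (hg : LocallyIntegrable g)
    (h : ∀ χ : V → ℝ, ContDiff ℝ ∞ χ → HasCompactSupport χ → ∀ v,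
      ∫ x, g x * fderiv ℝ χ x v = 0) : ∃ k, g =ᵐ[volume] fun _ => k := by
  -- Outer radius twice the inner one: a bounded ratio of radii is what almost everywhere
  -- convergence of the mollifications needs.
  let φ : ℕ → ContDiffBump (0 : V) := fun n =>
    ⟨1 / ((n : ℝ) + 1), 2 * (1 / ((n : ℝ) + 1)), by positivity, by
      have : (0 : ℝ) < 1 / ((n : ℝ) + 1) := by positivity
      linarith⟩
  have hφ0 : Tendsto (fun n => (φ n).rOut) atTop (𝓝 0) := by
    have := (tendsto_one_div_add_atTop_nhds_zero_nat (𝕜 := ℝ)).const_mul 2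
    rwa [mul_zero] at this
  have hlim := ContDiffBump.ae_convolution_tendsto_right_of_locallyIntegrable (μ := volume)
    (K := 2) hφ0 (Eventually.of_forall fun n => le_rfl) hg
  have hconst : ∀ n x y, ((φ n).normed volume ⋆[ContinuousLinearMap.lsmul ℝ ℝ, volume] g) x =
      ((φ n).normed volume ⋆[ContinuousLinearMap.lsmul ℝ ℝ, volume] g) y := by
    intro n
    have hs : ContDiff ℝ ∞ ((φ n).normed volume) := (φ n).contDiff_normed
    have hc : HasCompactSupport ((φ n).normed volume) := (φ n).hasCompactSupport_normed
    have hd := hc.hasFDerivAt_convolution_left (ContinuousLinearMap.lsmul ℝ ℝ)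
      (hs.of_le (by simp)) hg
    refine is_const_of_fderiv_eq_zero (𝕜 := ℝ) (fun x => (hd x).differentiableAt) fun x => ?_
    rw [(hd x).fderiv]
    ext v
    have hex := (hc.fderiv (𝕜 := ℝ)).convolutionExists_left
      ((ContinuousLinearMap.lsmul ℝ ℝ : ℝ →L[ℝ] ℝ →L[ℝ] ℝ).precompL V)
      (hs.continuous_fderiv (by simp)) hg x
    rw [convolution_def, ContinuousLinearMap.integral_apply hex]
    simpa using integral_comp_sub_mul_fderiv h hs hc x v
  obtain ⟨x₀, hx₀⟩ := hlim.exists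
  refine ⟨g x₀, ?_⟩
  filter_upwards [hlim] with x hx
  exact tendsto_nhds_unique hx (hx₀.congr fun n => hconst n x₀ x)

end WeakGradient

/-! ### Difference quotients of test functions -/

section DifferenceQuotients

open Filter Topology Real
open scoped ContDiff RealInnerProductSpace

lemma integral_mul_sq_le {α : Type*} {m : MeasurableSpace α} {μ : Measure α} {a b : α → ℝ}
    (ha : MemLp a 2 μ) (hb : MemLp b 2 μ) :
    (∫ x, a x * b x ∂μ) ^ 2 ≤ (∫ x, a x ^ 2 ∂μ) * ∫ x, b x ^ 2 ∂μ := by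
  have key := real_inner_mul_inner_self_le (ha.toLp a) (hb.toLp b)
  have hin : ∀ {u v : α → ℝ} (hu : MemLp u 2 μ) (hv : MemLp v 2 μ),
      ⟪hu.toLp u, hv.toLp v⟫ = ∫ x, u x * v x ∂μ := fun hu hv => by
    rw [L2.inner_def]
    refine integral_congr_ae ?_
    filter_upwards [hu.coeFn_toLp, hv.coeFn_toLp] with x h1 h2
    rw [h1, h2]; simp [mul_comm]
  rw [hin, hin, hin] at key
  simpa only [sq] using key

lemma memLp_test {V : Type*} [NormedAddCommGroup V] [InnerProductSpace ℝ V]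
    [FiniteDimensional ℝ V] [MeasurableSpace V] [BorelSpace V] {ψ : V → ℝ}
    (hψ : Continuous ψ) (hc : HasCompactSupport ψ) : MemLp ψ 2 :=
  hψ.memLp_of_hasCompactSupport hc

lemma tendsto_integral_mul_difference_quotient {V : Type*} [NormedAddCommGroup V]
    [InnerProductSpace ℝ V] [FiniteDimensional ℝ V] [MeasurableSpace V] [BorelSpace V]
    {F ψ : V → ℝ} (hF : MemLp F 2) (hψ : ContDiff ℝ ∞ ψ) (hc : HasCompactSupport ψ) (e : V) :
    Tendsto (fun t : ℝ => ∫ x, F x * (t⁻¹ * (ψ (x + -(t • e)) - ψ x))) (𝓝[>] 0)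
      (𝓝 (-∫ x, F x * fderiv ℝ ψ x e)) := by
  -- For `0 < t < 1` the difference quotient is supported in this compact set, so `F` may be cut off
  -- to an integrable function.
  set K := Metric.cthickening ‖e‖ (tsupport ψ) with hK
  have hKc : IsCompact K := IsCompact.cthickening hc
  obtain ⟨C, hC⟩ := ContDiff.lipschitzWith_of_hasCompactSupport hc hψ (by simp)
  have hFK : Integrable (K.indicator F) :=
    (((locallyIntegrable_of_memLp_two hF).integrableOn_isCompact hKc)).integrable_indicator
      hKc.measurableSet
  have hlim := hC.integral_inv_smul_sub_mul_tendsto_integral_lineDeriv_mul hFK (-e)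
  have hsub : tsupport ψ ⊆ K := Metric.self_subset_cthickening _
  have hout : ∀ x, x ∉ K → ψ x = 0 := fun x hx => image_eq_zero_of_notMem_tsupport
    fun h => hx (hsub h)
  have hval : ∫ x, lineDeriv ℝ ψ x (-e) * K.indicator F x = -∫ x, F x * fderiv ℝ ψ x e := by
    rw [← integral_neg]
    refine integral_congr_ae (ae_of_all _ fun x => ?_)
    simp only [(hψ.differentiable (by simp) x).lineDeriv_eq_fderiv, map_neg]
    by_cases hx : x ∈ K
    · rw [Set.indicator_of_mem hx]; ring
    · have : fderiv ℝ ψ x = 0 := image_eq_zero_of_notMem_tsupport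
        fun h => hx (hsub (tsupport_fderiv_subset ℝ h))
      simp [this]
  rw [hval] at hlim
  refine hlim.congr' ?_
  have h1 : ∀ᶠ t : ℝ in 𝓝[>] 0, t < 1 :=
    nhdsWithin_le_nhds (Iio_mem_nhds one_pos)
  filter_upwards [h1, self_mem_nhdsWithin] with t ht1 ht0
  refine integral_congr_ae (ae_of_all _ fun x => ?_)
  simp only [smul_neg, smul_eq_mul]
  by_cases hx : x ∈ K
  · rw [Set.indicator_of_mem hx]; ring
  · have h2 : ψ (x + -(t • e)) = 0 := by
      refine image_eq_zero_of_notMem_tsupport fun h => hx ?_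
      refine Metric.mem_cthickening_of_dist_le x _ _ _ h ?_
      rw [dist_eq_norm, sub_add_cancel_left, neg_neg, norm_smul, Real.norm_of_nonneg (le_of_lt ht0)]
      exact mul_le_of_le_one_left (norm_nonneg _) ht1.le
    simp [h2, hout x hx]

end DifferenceQuotients

/-! ### The uncertainty inequality and its extremals -/

section Heisenberg

open Filter Topology Real
open scoped ContDiff RealInnerProductSpace

variable {N : ℕ}

/-- The `i`-th standard basis vector. -/
noncomputable abbrev basisVec (i : Fin N) : Space N := EuclideanSpace.single i 1

/-- The weighted function `x ↦ (xᵢ - cᵢ) f(x)`. -/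
def weighted (f : Space N → ℝ) (c : Space N) (i : Fin N) (x : Space N) : ℝ := (x i - c i) * f x

/-- The difference quotient of `f` plus `λ` times a symmetrised version of `weighted f c i`. Its
vanishing in the limit characterises Gaussians of centre `c`. -/
noncomputable def defect (f : Space N → ℝ) (c : Space N) (lam : ℝ) (i : Fin N) (t : ℝ)
    (x : Space N) : ℝ :=
  t⁻¹ * (f (x + t • basisVec i) - f x) +
    lam / 2 * (weighted f c i (x + t • basisVec i) - t * f (x + t • basisVec i) + weighted f c i x)

lemma integrable_add_const_mul {α : Type*} {m : MeasurableSpace α} {μ : Measure α} {F G : α → ℝ}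
    (hF : Integrable F μ) (b : ℝ) (hG : Integrable G μ) :
    Integrable (fun x => F x + b * G x) μ := hF.add (hG.const_mul b)

lemma integral_add_const_mul {α : Type*} {m : MeasurableSpace α} {μ : Measure α} {F G : α → ℝ}
    (hF : Integrable F μ) (b : ℝ) (hG : Integrable G μ) :
    ∫ x, F x + b * G x ∂μ = (∫ x, F x ∂μ) + b * ∫ x, G x ∂μ := by
  rw [integral_add hF (hG.const_mul b), integral_const_mul]

variable {f : Space N → ℝ} {c : Space N}

lemma memLp_weighted (hf : MemLp f 2) (hx : MemLp (fun x => ‖x‖ * f x) 2) (c : Space N)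
    (i : Fin N) : MemLp (weighted f c i) 2 := by
  have h1 : MemLp (fun x : Space N => x i * f x) 2 := by
    refine hx.of_le ?_ (ae_of_all _ fun x => ?_)
    · exact (by fun_prop : Continuous fun x : Space N => x i).aestronglyMeasurable.mul hf.1
    · rw [norm_mul, norm_mul, norm_norm]
      exact mul_le_mul_of_nonneg_right (PiLp.norm_apply_le x i) (norm_nonneg _)
  refine (h1.sub (hf.const_mul (c i))).ae_eq (ae_of_all _ fun x => ?_)
  simp only [weighted, Pi.sub_apply]; ring

lemma memLp_defect (hf : MemLp f 2) (hx : MemLp (fun x => ‖x‖ * f x) 2) (c : Space N) (lam : ℝ)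
    (i : Fin N) (t : ℝ) : MemLp (defect f c lam i t) 2 := by
  have hp := memLp_weighted hf hx c i
  exact (((memLp_comp_add hf (t • basisVec i)).sub hf).const_mul t⁻¹).add
    ((((memLp_comp_add hp (t • basisVec i)).sub
      ((memLp_comp_add hf (t • basisVec i)).const_mul t)).add hp).const_mul (lam / 2))

lemma weighted_add (t : ℝ) (i : Fin N) (x : Space N) :
    weighted f c i (x + t • basisVec i) = (x i + t - c i) * f (x + t • basisVec i) := by
  simp [weighted]

/-- With `y = xᵢ - cᵢ`, the defect is the difference quotient plus `λy` times the mean of `f (x +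
te)` and `f x`. This symmetrisation makes the cross term `λt⁻¹y(f(x + te)² - f(x)²)`, whose integral
is exactly `-λ∫f²` after translation: integration by parts with no error term. -/
lemma integral_defect_sq_le (hf : MemLp f 2) (hx : MemLp (fun x => ‖x‖ * f x) 2) (lam : ℝ)
    (i : Fin N) {t : ℝ} (ht : t ≠ 0) :
    ∫ x, defect f c lam i t x ^ 2 ≤
      (t⁻¹) ^ 2 * (∫ x, (f (x + t • basisVec i) - f x) ^ 2) - lam * (∫ x, f x ^ 2) +
        lam ^ 2 * ((∫ x, weighted f c i x ^ 2) - t * (∫ x, weighted f c i x * f x) +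
          t ^ 2 / 2 * ∫ x, f x ^ 2) := by
  have hp := memLp_weighted hf hx c i
  set e := t • basisVec i with he
  have hfe := memLp_comp_add hf e
  have hpe := memLp_comp_add hp e
  have i1 : Integrable fun x => (f (x + e) - f x) ^ 2 := (hfe.sub hf).integrable_sq
  have i2 : Integrable fun x => f x ^ 2 := hf.integrable_sq
  have i3 : Integrable fun x => f (x + e) ^ 2 := hfe.integrable_sq
  have i4 : Integrable fun x => weighted f c i x ^ 2 := hp.integrable_sq
  have i5 : Integrable fun x => weighted f c i (x + e) ^ 2 := hpe.integrable_sq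
  have i6 : Integrable fun x => weighted f c i x * f x := hp.integrable_mul hf
  have i7 : Integrable fun x => weighted f c i (x + e) * f (x + e) := hpe.integrable_mul hfe
  have e3 : ∫ x, f (x + e) ^ 2 = ∫ x, f x ^ 2 :=
    integral_add_right_eq_self (fun x => f x ^ 2) e
  have e5 : ∫ x, weighted f c i (x + e) ^ 2 = ∫ x, weighted f c i x ^ 2 :=
    integral_add_right_eq_self (fun x => weighted f c i x ^ 2) e
  have e7 : ∫ x, weighted f c i (x + e) * f (x + e) = ∫ x, weighted f c i x * f x :=
    integral_add_right_eq_self (fun x => weighted f c i x * f x) e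
  have j1 := integrable_add_const_mul (integrable_add_const_mul (integrable_add_const_mul
    (integrable_add_const_mul (i1.const_mul ((t⁻¹) ^ 2)) (lam * t⁻¹ - lam ^ 2 * t) i7)
    (-(lam * t⁻¹)) i6) (lam ^ 2 * t ^ 2 / 2 - lam) i3) (lam ^ 2 / 2) i5
  calc ∫ x, defect f c lam i t x ^ 2
      ≤ ∫ x, ((t⁻¹) ^ 2 * (f (x + e) - f x) ^ 2 +
          (lam * t⁻¹ - lam ^ 2 * t) * (weighted f c i (x + e) * f (x + e)) +
          -(lam * t⁻¹) * (weighted f c i x * f x) +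
          (lam ^ 2 * t ^ 2 / 2 - lam) * f (x + e) ^ 2 +
          lam ^ 2 / 2 * weighted f c i (x + e) ^ 2 + lam ^ 2 / 2 * weighted f c i x ^ 2) := by
        refine integral_mono (memLp_defect hf hx c lam i t).integrable_sq
          (integrable_add_const_mul j1 _ i4) fun x => ?_
        have hti : t⁻¹ * t = 1 := inv_mul_cancel₀ ht
        simp only [defect, ← he]
        rw [he, weighted_add, ← he]
        simp only [weighted]
        set a := f (x + e)
        set b := f x
        set y := x i - c i
        have hy : x i + t - c i = y + t := by ring
        rw [hy]
        -- The only loss: the square of a mean is at most the mean of the squares, the gap being a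
        -- quarter of this quantity.
        have hsq := mul_nonneg (sq_nonneg lam) (sq_nonneg (y * a - y * b))
        have hexp : (t⁻¹ * (a - b) + lam / 2 * ((y + t) * a - t * a + y * b)) ^ 2 =
            (t⁻¹) ^ 2 * (a - b) ^ 2 + lam * t⁻¹ * y * (a ^ 2 - b ^ 2)
              + lam ^ 2 / 4 * (y * a + y * b) ^ 2 := by ring
        -- Writing `y` as `(y + t) - t` beside `a` expresses every term through translates of `f`
        -- and of `weighted f c i`, which are integrable separately.
        have hrhs : (t⁻¹) ^ 2 * (a - b) ^ 2 + (lam * t⁻¹ - lam ^ 2 * t) * ((y + t) * a * a) +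
          -(lam * t⁻¹) * (y * b * b) + (lam ^ 2 * t ^ 2 / 2 - lam) * a ^ 2 +
          lam ^ 2 / 2 * ((y + t) * a) ^ 2 + lam ^ 2 / 2 * (y * b) ^ 2 =
            (t⁻¹) ^ 2 * (a - b) ^ 2 +
            lam * t⁻¹ * y * (a ^ 2 - b ^ 2) + lam ^ 2 / 2 * ((y * a) ^ 2 + (y * b) ^ 2) := by
          linear_combination (lam * a ^ 2) * hti
        rw [hexp, hrhs]
        nlinarith
    _ = _ := by
        rw [integral_add_const_mul j1 _ i4, integral_add_const_mul (integrable_add_const_mul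
            (integrable_add_const_mul (integrable_add_const_mul (i1.const_mul _) _ i7) _ i6) _ i3)
            _ i5,
          integral_add_const_mul (integrable_add_const_mul (integrable_add_const_mul
            (i1.const_mul _) _ i7) _ i6) _ i3,
          integral_add_const_mul (integrable_add_const_mul (i1.const_mul _) _ i7) _ i6,
          integral_add_const_mul (i1.const_mul _) _ i7, integral_const_mul, e3, e5, e7]
        ring

lemma sum_weighted_sq (x : Space N) :
    ∑ i, weighted f c i x ^ 2 = ‖x - c‖ ^ 2 * f x ^ 2 := by
  simp only [weighted, mul_pow, ← Finset.sum_mul, EuclideanSpace.norm_sq_eq]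
  simp

lemma sum_integral_weighted_sq (hf : MemLp f 2) (hx : MemLp (fun x => ‖x‖ * f x) 2) :
    ∑ i, ∫ x, weighted f c i x ^ 2 = ∫ x, ‖x - c‖ ^ 2 * f x ^ 2 := by
  rw [← integral_finsetSum _ fun i _ => (memLp_weighted hf hx c i).integrable_sq]
  simp only [sum_weighted_sq]

/-- The quadratic in `λ` whose nonnegativity is the uncertainty inequality. -/
noncomputable def uncertaintyForm (f : Space N → ℝ) (c : Space N) (W lam : ℝ) : ℝ :=
  4 * π ^ 2 * W - lam * N * (∫ x, f x ^ 2) + lam ^ 2 * ∫ x, ‖x - c‖ ^ 2 * f x ^ 2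

variable {W : Fin N → ℝ}

lemma sum_integral_defect_sq_le (hf : MemLp f 2) (hx : MemLp (fun x => ‖x‖ * f x) 2)
    (hW : ∀ i t, ∫ x, (f (x + t • basisVec i) - f x) ^ 2 ≤ 4 * π ^ 2 * t ^ 2 * W i) (lam : ℝ)
    {t : ℝ} (ht : t ≠ 0) :
    ∑ i, ∫ x, defect f c lam i t x ^ 2 ≤ uncertaintyForm f c (∑ i, W i) lam +
      lam ^ 2 * (-t * (∑ i, ∫ x, weighted f c i x * f x) + t ^ 2 / 2 * (N * ∫ x, f x ^ 2)) := by
  have h : ∀ i, ∫ x, defect f c lam i t x ^ 2 ≤ 4 * π ^ 2 * W i - lam * (∫ x, f x ^ 2) +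
        lam ^ 2 * ((∫ x, weighted f c i x ^ 2) - t * (∫ x, weighted f c i x * f x) +
          t ^ 2 / 2 * ∫ x, f x ^ 2) := fun i => by
    refine (integral_defect_sq_le hf hx lam i ht).trans ?_
    have h1 := mul_le_mul_of_nonneg_left (hW i t) (sq_nonneg t⁻¹)
    have h2 : (t⁻¹) ^ 2 * (4 * π ^ 2 * t ^ 2 * W i) = 4 * π ^ 2 * W i := by field_simp
    linarith
  refine (Finset.sum_le_sum fun i _ => h i).trans (le_of_eq ?_)
  simp only [Finset.sum_add_distrib, Finset.sum_sub_distrib, ← Finset.mul_sum,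
    sum_integral_weighted_sq hf hx, Finset.sum_const, Finset.card_univ, Fintype.card_fin,
    nsmul_eq_mul, uncertaintyForm]
  ring

lemma tendsto_sum_integral_defect_bound (Q A B lam : ℝ) :
    Tendsto (fun t : ℝ => Q + lam ^ 2 * (-t * A + t ^ 2 / 2 * B)) (𝓝[>] 0) (𝓝 Q) := by
  have : Continuous fun t : ℝ => Q + lam ^ 2 * (-t * A + t ^ 2 / 2 * B) := by fun_prop
  simpa using (this.tendsto 0).mono_left nhdsWithin_le_nhds

lemma uncertaintyForm_nonneg (hf : MemLp f 2) (hx : MemLp (fun x => ‖x‖ * f x) 2)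
    (hW : ∀ i t, ∫ x, (f (x + t • basisVec i) - f x) ^ 2 ≤ 4 * π ^ 2 * t ^ 2 * W i) (lam : ℝ) :
    0 ≤ uncertaintyForm f c (∑ i, W i) lam := by
  refine ge_of_tendsto (tendsto_sum_integral_defect_bound _ (∑ i, ∫ x, weighted f c i x * f x)
    (N * ∫ x, f x ^ 2) lam) ?_
  filter_upwards [self_mem_nhdsWithin] with t ht
  refine le_trans ?_ (sum_integral_defect_sq_le hf hx hW lam (ne_of_gt ht))
  exact Finset.sum_nonneg fun i _ => integral_nonneg fun x => sq_nonneg _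

lemma tendsto_integral_defect_sq (hf : MemLp f 2) (hx : MemLp (fun x => ‖x‖ * f x) 2)
    (hW : ∀ i t, ∫ x, (f (x + t • basisVec i) - f x) ^ 2 ≤ 4 * π ^ 2 * t ^ 2 * W i) {lam : ℝ}
    (hQ : uncertaintyForm f c (∑ i, W i) lam = 0) (i : Fin N) :
    Tendsto (fun t => ∫ x, defect f c lam i t x ^ 2) (𝓝[>] 0) (𝓝 0) := by
  have hlim := tendsto_sum_integral_defect_bound (uncertaintyForm f c (∑ i, W i) lam)
    (∑ i, ∫ x, weighted f c i x * f x) (N * ∫ x, f x ^ 2) lam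
  rw [hQ] at hlim
  refine tendsto_of_tendsto_of_tendsto_of_le_of_le' tendsto_const_nhds hlim
    (Eventually.of_forall fun t => integral_nonneg fun x => sq_nonneg _) ?_
  filter_upwards [self_mem_nhdsWithin] with t ht
  refine le_trans ?_ ((sum_integral_defect_sq_le hf hx hW lam (ne_of_gt ht)).trans_eq
    (by rw [hQ]))
  exact Finset.single_le_sum (f := fun i => ∫ x, defect f c lam i t x ^ 2)
    (fun i _ => integral_nonneg fun x => sq_nonneg _) (Finset.mem_univ i)

lemma integral_comp_add_mul {F ψ : Space N → ℝ} (e : Space N) :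
    ∫ x, F (x + e) * ψ x = ∫ x, F x * ψ (x + -e) := by
  rw [← integral_add_right_eq_self (fun x => F x * ψ (x + -e)) e]
  simp

/-- Discrete integration by parts: translations move onto the test function, whose difference
quotients converge. -/
lemma integral_defect_mul (hf : MemLp f 2) (hx : MemLp (fun x => ‖x‖ * f x) 2) {ψ : Space N → ℝ}
    (hψ : MemLp ψ 2) (lam : ℝ) (i : Fin N) {t : ℝ} (ht : t ≠ 0) :
    ∫ x, defect f c lam i t x * ψ x =
      (1 - lam / 2 * t ^ 2) * (∫ x, f x * (t⁻¹ * (ψ (x + -(t • basisVec i)) - ψ x))) +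
        lam / 2 * (t * (∫ x, weighted f c i x * (t⁻¹ * (ψ (x + -(t • basisVec i)) - ψ x))) +
          2 * (∫ x, weighted f c i x * ψ x) - t * ∫ x, f x * ψ x) := by
  have hp := memLp_weighted hf hx c i
  set e := t • basisVec i with he
  have hfe := memLp_comp_add hf e
  have hpe := memLp_comp_add hp e
  have hψe := memLp_comp_add hψ (-e)
  have i1 : Integrable fun x => f (x + e) * ψ x := hfe.integrable_mul hψ
  have i2 : Integrable fun x => f x * ψ x := hf.integrable_mul hψ
  have i3 : Integrable fun x => weighted f c i (x + e) * ψ x := hpe.integrable_mul hψ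
  have i4 : Integrable fun x => weighted f c i x * ψ x := hp.integrable_mul hψ
  have i5 : Integrable fun x => f x * ψ (x + -e) := hf.integrable_mul hψe
  have i6 : Integrable fun x => weighted f c i x * ψ (x + -e) := hp.integrable_mul hψe
  have q1 : ∫ x, f x * (t⁻¹ * (ψ (x + -e) - ψ x)) =
      t⁻¹ * (∫ x, f x * ψ (x + -e)) - t⁻¹ * ∫ x, f x * ψ x := by
    rw [← integral_const_mul, ← integral_const_mul,
      ← integral_sub (i5.const_mul _) (i2.const_mul _)]
    refine integral_congr_ae (ae_of_all _ fun x => ?_)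
    ring
  have q2 : ∫ x, weighted f c i x * (t⁻¹ * (ψ (x + -e) - ψ x)) =
      t⁻¹ * (∫ x, weighted f c i x * ψ (x + -e)) - t⁻¹ * ∫ x, weighted f c i x * ψ x := by
    rw [← integral_const_mul, ← integral_const_mul,
      ← integral_sub (i6.const_mul _) (i4.const_mul _)]
    refine integral_congr_ae (ae_of_all _ fun x => ?_)
    ring
  have hexp : ∀ x, defect f c lam i t x * ψ x =
      (t⁻¹ - lam / 2 * t) * (f (x + e) * ψ x) + -t⁻¹ * (f x * ψ x) +
        lam / 2 * (weighted f c i (x + e) * ψ x) + lam / 2 * (weighted f c i x * ψ x) := fun x => by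
    simp only [defect, ← he]; ring
  simp_rw [hexp]
  rw [integral_add_const_mul (integrable_add_const_mul (integrable_add_const_mul
      (i1.const_mul _) _ i2) _ i3) _ i4, integral_add_const_mul (integrable_add_const_mul
      (i1.const_mul _) _ i2) _ i3, integral_add_const_mul (i1.const_mul _) _ i2,
    integral_const_mul, integral_comp_add_mul, integral_comp_add_mul, q1, q2]
  field_simp
  ring

/-- At a root of the quadratic the defect tends to zero in `L²`, hence against `ψ` by
Cauchy–Schwarz; comparing with the limit of `integral_defect_mul` gives the first-order equation of
a Gaussian in weak form. -/
lemma weak_derivative_eq (hf : MemLp f 2) (hx : MemLp (fun x => ‖x‖ * f x) 2)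
    (hW : ∀ i t, ∫ x, (f (x + t • basisVec i) - f x) ^ 2 ≤ 4 * π ^ 2 * t ^ 2 * W i) {lam : ℝ}
    (hQ : uncertaintyForm f c (∑ i, W i) lam = 0) (i : Fin N) {ψ : Space N → ℝ}
    (hψ : ContDiff ℝ ∞ ψ) (hc : HasCompactSupport ψ) :
    ∫ x, f x * fderiv ℝ ψ x (basisVec i) = lam * ∫ x, weighted f c i x * ψ x := by
  have hp := memLp_weighted hf hx c i
  have hψ2 := memLp_test hψ.continuous hc
  have hF := tendsto_integral_mul_difference_quotient hf hψ hc (basisVec i)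
  have hP := tendsto_integral_mul_difference_quotient hp hψ hc (basisVec i)
  have ht : Tendsto (fun t : ℝ => t) (𝓝[>] 0) (𝓝 0) := nhdsWithin_le_nhds
  have l1 : Tendsto (fun t => ∫ x, defect f c lam i t x * ψ x) (𝓝[>] 0)
      (𝓝 ((1 - lam / 2 * 0 ^ 2) * (-∫ x, f x * fderiv ℝ ψ x (basisVec i)) +
        lam / 2 * (0 * (-∫ x, weighted f c i x * fderiv ℝ ψ x (basisVec i)) +
          2 * (∫ x, weighted f c i x * ψ x) - 0 * ∫ x, f x * ψ x))) := by
    refine Tendsto.congr' (f₁ := fun t : ℝ =>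
      (1 - lam / 2 * t ^ 2) * (∫ x, f x * (t⁻¹ * (ψ (x + -(t • basisVec i)) - ψ x))) +
        lam / 2 * (t * (∫ x, weighted f c i x * (t⁻¹ * (ψ (x + -(t • basisVec i)) - ψ x))) +
          2 * (∫ x, weighted f c i x * ψ x) - t * ∫ x, f x * ψ x)) ?_ ?_
    · filter_upwards [self_mem_nhdsWithin] with t ht
      exact (integral_defect_mul hf hx hψ2 lam i (ne_of_gt ht)).symm
    · exact (((ht.pow 2).const_mul (lam / 2)).const_sub 1 |>.mul hF).add
        ((((ht.mul hP).add_const _).sub (ht.mul_const _)).const_mul (lam / 2))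
  have l2 : Tendsto (fun t => ∫ x, defect f c lam i t x * ψ x) (𝓝[>] 0) (𝓝 0) := by
    have hsq : Tendsto (fun t => (∫ x, defect f c lam i t x * ψ x) ^ 2) (𝓝[>] 0) (𝓝 0) := by
      have := (tendsto_integral_defect_sq hf hx hW hQ i).mul_const (∫ x, ψ x ^ 2)
      rw [zero_mul] at this
      exact tendsto_of_tendsto_of_tendsto_of_le_of_le tendsto_const_nhds this
        (fun t => sq_nonneg _) fun t => integral_mul_sq_le (memLp_defect hf hx c lam i t) hψ2
    have := hsq.sqrt
    simp only [Real.sqrt_sq_eq_abs, Real.sqrt_zero] at this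
    exact (tendsto_zero_iff_abs_tendsto_zero _).2 this
  have := tendsto_nhds_unique l1 l2
  linarith

/-- The smooth weight `e^{λ‖x - c‖² / 2}`. -/
noncomputable def gaussWeight (c : Space N) (lam : ℝ) (x : Space N) : ℝ :=
  rexp (lam / 2 * ‖x - c‖ ^ 2)

lemma contDiff_gaussWeight (c : Space N) (lam : ℝ) : ContDiff ℝ ∞ (gaussWeight c lam) := by
  unfold gaussWeight
  have : ContDiff ℝ ∞ fun x : Space N => ‖x - c‖ ^ 2 := (contDiff_id.sub contDiff_const).norm_sq ℝ
  fun_prop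

lemma fderiv_gaussWeight (c : Space N) (lam : ℝ) (x : Space N) (i : Fin N) :
    fderiv ℝ (gaussWeight c lam) x (basisVec i) = lam * (x i - c i) * gaussWeight c lam x := by
  have h1 : HasFDerivAt (fun x : Space N => ‖x - c‖ ^ 2)
      (2 • (innerSL ℝ (x - c)).comp (ContinuousLinearMap.id ℝ (Space N))) x :=
    ((hasFDerivAt_id x).sub_const c).norm_sq
  have h2 := ((h1.const_mul (lam / 2)).exp).fderiv
  have h3 : fderiv ℝ (gaussWeight c lam) x = _ := h2
  rw [h3]
  simp [gaussWeight, EuclideanSpace.inner_single_right]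
  ring

lemma exists_ae_eq_gaussian (hf : MemLp f 2) (hx : MemLp (fun x => ‖x‖ * f x) 2)
    (hW : ∀ i t, ∫ x, (f (x + t • basisVec i) - f x) ^ 2 ≤ 4 * π ^ 2 * t ^ 2 * W i) {lam : ℝ}
    (hQ : uncertaintyForm f c (∑ i, W i) lam = 0) :
    ∃ k, f =ᵐ[volume] fun x => k * rexp (-(lam / 2) * ‖x - c‖ ^ 2) := by
  have hGc : Continuous (gaussWeight c lam) := (contDiff_gaussWeight c lam).continuous
  have hloc : LocallyIntegrable fun x => f x * gaussWeight c lam x := by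
    have := (locallyIntegrable_of_memLp_two hf).smul_continuous hGc
    simpa only [smul_eq_mul, mul_comm] using this
  obtain ⟨k, hk⟩ := exists_ae_eq_const_of_weak_gradient_eq_zero hloc fun χ hχ hχc v => by
    have hd : ∀ x, fderiv ℝ χ x v = ∑ i, v i * fderiv ℝ χ x (basisVec i) := fun x => by
      have hv : v = ∑ i, v i • basisVec i := by
        ext j
        simp [Finset.sum_apply, Pi.single_apply]
      conv_lhs => rw [hv]
      simp
    have hdc : ∀ i, Continuous fun x => fderiv ℝ χ x (basisVec i) := fun i =>
      (hχ.continuous_fderiv (by simp)).clm_apply continuous_const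
    have hds : ∀ i, HasCompactSupport fun x => fderiv ℝ χ x (basisVec i) := fun i =>
      (hχc.fderiv (𝕜 := ℝ)).comp_left (g := fun L : Space N →L[ℝ] ℝ => L (basisVec i)) rfl
    have hint : ∀ i, Integrable fun x =>
        f x * (gaussWeight c lam x * fderiv ℝ χ x (basisVec i)) := fun i =>
      hf.integrable_mul (memLp_test (hGc.mul (hdc i)) ((hds i).mul_left))
    have hzero : ∀ i, ∫ x, f x * (gaussWeight c lam x * fderiv ℝ χ x (basisVec i)) = 0 := by
      intro i
      -- The weak equation is tested with the integrating factor times `χ`; differentiating the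
      -- weight produces exactly the term that cancels the right-hand side.
      have hψ : ContDiff ℝ ∞ fun x => gaussWeight c lam x * χ x :=
        (contDiff_gaussWeight c lam).mul hχ
      have hψc : HasCompactSupport fun x => gaussWeight c lam x * χ x := hχc.mul_left
      have key := weak_derivative_eq hf hx hW hQ i hψ hψc
      have hder : ∀ x, fderiv ℝ (fun x => gaussWeight c lam x * χ x) x (basisVec i) =
          gaussWeight c lam x * fderiv ℝ χ x (basisVec i) +
            lam * (x i - c i) * gaussWeight c lam x * χ x := fun x => by
        rw [fderiv_fun_mul ((contDiff_gaussWeight c lam).differentiable (by simp) x)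
          (hχ.differentiable (by simp) x)]
        simp only [add_apply, smul_apply, smul_eq_mul,
          fderiv_gaussWeight]
        ring
      have hi2 : Integrable fun x => weighted f c i x * (gaussWeight c lam x * χ x) :=
        (memLp_weighted hf hx c i).integrable_mul (memLp_test hψ.continuous hψc)
      have hsplit : ∀ x, f x * fderiv ℝ (fun x => gaussWeight c lam x * χ x) x (basisVec i) =
          f x * (gaussWeight c lam x * fderiv ℝ χ x (basisVec i)) +
            lam * (weighted f c i x * (gaussWeight c lam x * χ x)) := fun x => by
        rw [hder, weighted]; ring
      simp_rw [hsplit] at key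
      rw [integral_add (hint i) (hi2.const_mul _), integral_const_mul] at key
      linarith
    have hsum : ∀ x, f x * gaussWeight c lam x * fderiv ℝ χ x v =
        ∑ i, v i * (f x * (gaussWeight c lam x * fderiv ℝ χ x (basisVec i))) := fun x => by
      rw [hd, Finset.mul_sum]
      exact Finset.sum_congr rfl fun i _ => by ring
    simp_rw [hsum]
    rw [integral_finsetSum _ fun i _ => (hint i).const_mul _]
    simp [integral_const_mul, hzero]
  refine ⟨k, ?_⟩
  filter_upwards [hk] with x hx
  rw [← hx, gaussWeight, mul_assoc, ← Real.exp_add]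
  simp

end Heisenberg

/-! ### From almost everywhere to everywhere -/

section LineContinuity

open Filter Topology

variable {N : ℕ}

lemma ae_ae_line {P : Space N → Prop} (hP : ∀ᵐ x, P x) (v : Space N) :
    ∀ᵐ x : Space N, ∀ᵐ t : ℝ, P (x + t • v) := by
  obtain ⟨s, hs, hsm, hs0⟩ := exists_measurable_superset_of_null (ae_iff.1 hP)
  have h1 : ∀ᵐ x, x ∈ sᶜ := by rw [ae_iff]; simpa using hs0
  have h2 := (ae_ae_add_linearMap_mem_iff (LinearMap.toSpanSingleton ℝ (Space N) v) volume volume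
    hsm.compl).2 h1
  filter_upwards [h2] with x hx
  filter_upwards [hx] with t ht
  by_contra hcon
  exact ht (hs hcon)

/-- A function which is continuous along the coordinate lines and vanishes almost everywhere
vanishes identically. -/
lemma eq_zero_of_ae_eq_zero_of_line_continuous {h : Space N → ℝ}
    (hc : ∀ x i, Continuous fun t : ℝ => h (x + t • basisVec i)) (h0 : h =ᵐ[volume] 0)
    (x : Space N) : h x = 0 := by
  -- Continuity along coordinate lines does not give joint continuity, so coordinates are freed one
  -- at a time; once all are free, a single good `x` covers the whole space.
  have key : ∀ S : Finset (Fin N), ∀ᵐ x : Space N, ∀ z : Space N, (∀ j ∉ S, z j = x j) → h z = 0 := by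
    intro S
    induction S using Finset.induction_on with
    | empty =>
      filter_upwards [h0] with x hx z hz
      have : z = x := by ext j; exact hz j (Finset.notMem_empty j)
      rw [this, hx]; rfl
    | insert i S _ ih =>
      filter_upwards [ae_ae_line ih (basisVec i)] with x hx z hz
      -- The offset gives the point at parameter `t` the `i`-th coordinate `x i + t`, aligning it
      -- with the line through `x`; `z` itself sits at `t = z i - x i`.
      have hcont : Continuous fun t : ℝ => h (z + (t + (x i - z i)) • basisVec i) :=
        (hc z i).comp (continuous_add_const (x i - z i))
      have hzero : (fun t : ℝ => h (z + (t + (x i - z i)) • basisVec i)) =ᵐ[volume]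
          fun _ => 0 := by
        filter_upwards [hx] with t ht
        refine ht _ fun j hj => ?_
        by_cases hji : j = i
        · subst hji; simp; ring
        · have := hz j (by simp [hji, hj])
          simp [hji, this]
      have := congrFun ((hcont.ae_eq_iff_eq volume continuous_const).1 hzero) (z i - x i)
      simpa using this
  obtain ⟨y, hy⟩ := (key Finset.univ).exists
  exact hy x (by simp)

lemma line_continuous_of_lineDifferentiableAt {f : Space N → ℝ} {v : Space N}
    (hf : ∀ x, LineDifferentiableAt ℝ f x v) (x : Space N) :
    Continuous fun t : ℝ => f (x + t • v) := by
  refine continuous_iff_continuousAt.2 fun s => ?_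
  have h1 : ContinuousAt (fun t : ℝ => f (x + s • v + t • v)) (s - s) := by
    rw [sub_self]
    have := hf (x + s • v)
    rw [LineDifferentiableAt] at this
    exact this.continuousAt
  have h2 : ContinuousAt (fun t : ℝ => t - s) s := by fun_prop
  refine (ContinuousAt.comp (f := fun t : ℝ => t - s) h1 h2).congr
    (Eventually.of_forall fun t => ?_)
  simp only [Function.comp]
  congr 1
  module

end LineContinuity

/-! ### Second moments of Gaussians and of their transforms -/

section GaussianMoments

open Real Filter Topology
open scoped ContDiff

variable {N : ℕ}

lemma gaussWeight_zero_center (a : ℝ) (x : Space N) :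
    gaussWeight 0 (-2 * a) x = rexp (-a * ‖x‖ ^ 2) := by
  simp only [gaussWeight, sub_zero]
  congr 1; ring

lemma integrable_exp_neg_mul_norm_sq {a : ℝ} (ha : 0 < a) :
    Integrable fun x : Space N => rexp (-a * ‖x‖ ^ 2) := by
  have h := (GaussianFourier.integrable_cexp_neg_mul_sq_norm_add (V := Space N) (b := (a : ℂ))
    (by simpa using ha) 0 0).norm
  refine h.congr (ae_of_all _ fun x => ?_)
  simp only [zero_mul, add_zero, Complex.norm_exp]
  congr 1
  norm_cast

/-- Half of the exponential decay absorbs the quadratic factor, by `s ≤ e^s` at `s = a‖x‖²/2`. -/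
lemma integrable_norm_sq_mul_exp {a : ℝ} (ha : 0 < a) :
    Integrable fun x : Space N => ‖x‖ ^ 2 * rexp (-a * ‖x‖ ^ 2) := by
  refine ((integrable_exp_neg_mul_norm_sq (N := N) (half_pos ha)).const_mul (2 / a)).mono
    (by fun_prop) (ae_of_all _ fun x => ?_)
  rw [norm_mul, norm_mul, Real.norm_of_nonneg (by positivity : (0 : ℝ) ≤ ‖x‖ ^ 2),
    Real.norm_of_nonneg (by positivity : (0 : ℝ) ≤ 2 / a), Real.norm_of_nonneg (exp_pos _).le,
    Real.norm_of_nonneg (exp_pos _).le]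
  have h1 : a / 2 * ‖x‖ ^ 2 ≤ rexp (a / 2 * ‖x‖ ^ 2) := by
    linarith [add_one_le_exp (a / 2 * ‖x‖ ^ 2)]
  have h2 : ‖x‖ ^ 2 ≤ 2 / a * rexp (a / 2 * ‖x‖ ^ 2) := by
    rw [div_mul_eq_mul_div, le_div_iff₀ ha]; linarith
  calc ‖x‖ ^ 2 * rexp (-a * ‖x‖ ^ 2)
      ≤ 2 / a * rexp (a / 2 * ‖x‖ ^ 2) * rexp (-a * ‖x‖ ^ 2) :=
        mul_le_mul_of_nonneg_right h2 (exp_pos _).le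
    _ = 2 / a * rexp (-(a / 2) * ‖x‖ ^ 2) := by
        rw [mul_assoc, ← Real.exp_add]; congr 2; ring

/-- Integration by parts of `xᵢ` against `∂ᵢG = -2axᵢG`. -/
lemma integral_coord_sq_mul_exp {a : ℝ} (ha : 0 < a) (i : Fin N) :
    ∫ x : Space N, x i ^ 2 * rexp (-a * ‖x‖ ^ 2) =
      1 / (2 * a) * ∫ x : Space N, rexp (-a * ‖x‖ ^ 2) := by
  have hG := contDiff_gaussWeight (0 : Space N) (-2 * a)
  have hcoord : ∀ x : Space N, HasFDerivAt (fun y : Space N => y i)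
      (EuclideanSpace.proj i : Space N →L[ℝ] ℝ) x :=
    fun x => (EuclideanSpace.proj i : Space N →L[ℝ] ℝ).hasFDerivAt
  have i0 : Integrable (gaussWeight (0 : Space N) (-2 * a)) :=
    (integrable_exp_neg_mul_norm_sq ha).congr
      (ae_of_all _ fun x => (gaussWeight_zero_center a x).symm)
  have i2 : Integrable fun x : Space N => x i ^ 2 * gaussWeight (0 : Space N) (-2 * a) x := by
    refine (integrable_norm_sq_mul_exp (N := N) ha).mono
      (by have := hG.continuous; fun_prop) (ae_of_all _ fun x => ?_)
    rw [gaussWeight_zero_center, norm_mul, norm_mul, norm_pow, norm_pow, norm_norm]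
    gcongr
    exact PiLp.norm_apply_le x i
  have i1 : Integrable fun x : Space N => x i * gaussWeight (0 : Space N) (-2 * a) x := by
    refine (i0.add i2).mono (by have := hG.continuous; fun_prop) (ae_of_all _ fun x => ?_)
    simp only [Pi.add_apply, gaussWeight_zero_center]
    have h1 : |x i| ≤ 1 + x i ^ 2 := by
      rw [← sq_abs]; nlinarith [sq_nonneg (|x i| - 1), abs_nonneg (x i)]
    rw [← one_add_mul, norm_mul, norm_mul, Real.norm_eq_abs, Real.norm_of_nonneg
      (by positivity : 0 ≤ 1 + x i ^ 2)]
    exact mul_le_mul_of_nonneg_right h1 (norm_nonneg _)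
  have hder : ∀ x : Space N, x i * fderiv ℝ (gaussWeight (0 : Space N) (-2 * a)) x (basisVec i) =
      -2 * a * (x i ^ 2 * gaussWeight (0 : Space N) (-2 * a) x) := fun x => by
    rw [fderiv_gaussWeight]; simp; ring
  have hder' : ∀ x : Space N, fderiv ℝ (fun y : Space N => y i) x (basisVec i) = 1 := fun x => by
    rw [(hcoord x).fderiv]; simp
  have key := integral_mul_fderiv_eq_neg_fderiv_mul_of_integrable (μ := (volume : Measure (Space N)))
    (f := fun y : Space N => y i) (g := gaussWeight (0 : Space N) (-2 * a)) (v := basisVec i)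
    (by simpa only [hder', one_mul] using i0) (by simp only [hder]; exact i2.const_mul _) i1
    (fun x _ => (hcoord x).differentiableAt) (fun x _ => hG.differentiable (by simp) x)
  simp only [hder, hder', one_mul, integral_const_mul, gaussWeight_zero_center] at key
  rw [show ∫ x : Space N, rexp (-a * ‖x‖ ^ 2) =
    2 * a * ∫ x : Space N, x i ^ 2 * rexp (-a * ‖x‖ ^ 2) by linarith, ← mul_assoc,
    one_div_mul_cancel (by positivity), one_mul]

/-- The second moment of a centred Gaussian density. -/
lemma integral_norm_sq_mul_exp {a : ℝ} (ha : 0 < a) :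
    ∫ x : Space N, ‖x‖ ^ 2 * rexp (-a * ‖x‖ ^ 2) =
      N / (2 * a) * ∫ x : Space N, rexp (-a * ‖x‖ ^ 2) := by
  have h : ∀ x : Space N, ‖x‖ ^ 2 * rexp (-a * ‖x‖ ^ 2) =
      ∑ i, x i ^ 2 * rexp (-a * ‖x‖ ^ 2) := fun x => by
    rw [← Finset.sum_mul]
    congr 1
    simp [EuclideanSpace.norm_sq_eq]
  have hi : ∀ i, Integrable fun x : Space N => x i ^ 2 * rexp (-a * ‖x‖ ^ 2) := fun i => by
    refine (integrable_norm_sq_mul_exp (N := N) ha).mono (by fun_prop) (ae_of_all _ fun x => ?_)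
    rw [norm_mul, norm_mul, norm_pow, norm_pow, norm_norm]
    gcongr
    exact PiLp.norm_apply_le x i
  simp_rw [h]
  rw [integral_finsetSum _ fun i _ => hi i]
  simp only [integral_coord_sq_mul_exp ha, Finset.sum_const, Finset.card_univ, Fintype.card_fin,
    nsmul_eq_mul]
  ring

lemma integral_norm_sub_sq_mul_gaussian {f : Space N → ℝ} {k a : ℝ} {c : Space N} (ha : 0 < a)
    (hf : ∀ x, f x = k * rexp (-a * ‖x - c‖ ^ 2)) :
    ∫ x, ‖x - c‖ ^ 2 * f x ^ 2 = N / (4 * a) * ∫ x, f x ^ 2 := by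
  have h1 : ∀ x, f x ^ 2 = k ^ 2 * rexp (-(2 * a) * ‖x - c‖ ^ 2) := fun x => by
    rw [hf, mul_pow, ← Real.exp_nat_mul]; congr 2; push_cast; ring
  have h2 : ∀ x, ‖x - c‖ ^ 2 * f x ^ 2 =
      k ^ 2 * (‖x - c‖ ^ 2 * rexp (-(2 * a) * ‖x - c‖ ^ 2)) := fun x => by rw [h1]; ring
  simp_rw [h2, h1, integral_const_mul]
  rw [integral_sub_right_eq_self (fun x => ‖x‖ ^ 2 * rexp (-(2 * a) * ‖x‖ ^ 2)) c,
    integral_sub_right_eq_self (fun x => rexp (-(2 * a) * ‖x‖ ^ 2)) c,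
    integral_norm_sq_mul_exp (by positivity : 0 < 2 * a)]
  ring

/-- The centre `c` contributes only a phase. The value of `K` is immaterial, since only a ratio of
moments is used. -/
lemma exists_norm_l2Fourier_gaussian {f : Space N → ℝ} {k a : ℝ} {c : Space N} (ha : 0 < a)
    (hf : ∀ x, f x = k * rexp (-a * ‖x - c‖ ^ 2)) :
    ∃ K : ℝ, ∀ᵐ w, ‖l2Fourier (fun x => (f x : ℂ)) w‖ = K * rexp (-(π ^ 2 / a) * ‖w‖ ^ 2) := by
  set G : Space N → ℂ := fun v => Complex.exp (-(a : ℂ) * (‖v‖ : ℂ) ^ 2) with hG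
  have hGr : ∀ v, G v = ((rexp (-a * ‖v‖ ^ 2) : ℝ) : ℂ) := fun v => by
    simp only [hG]; push_cast; rfl
  have hGi : Integrable G := by
    have := (integrable_exp_neg_mul_norm_sq (N := N) ha).ofReal (𝕜 := ℂ)
    exact this.congr (ae_of_all _ fun v => (hGr v).symm)
  have hG2 : MemLp G 2 := by
    rw [memLp_two_iff_integrable_sq_norm hGi.1]
    refine (integrable_exp_neg_mul_norm_sq (N := N) (by positivity : 0 < 2 * a)).congr
      (ae_of_all _ fun v => ?_)
    simp only [hGr, Complex.norm_real, Real.norm_of_nonneg (exp_pos _).le]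
    rw [← Real.exp_nat_mul]; congr 1; push_cast; ring
  have hfG : (fun x => (f x : ℂ)) = fun x => (k : ℂ) * G (x + -c) := by
    funext x
    rw [hGr, hf, ← sub_eq_add_neg]; push_cast; rfl
  refine ⟨‖(k : ℂ)‖ * ‖((π : ℂ) / a) ^ (Module.finrank ℝ (Space N) / 2 : ℂ)‖, ?_⟩
  rw [hfG]
  filter_upwards [l2Fourier_const_mul (memLp_comp_add hG2 (-c)) (k : ℂ),
    l2Fourier_comp_add hG2 (-c), l2Fourier_ae_eq_fourier hG2 hGi] with w h1 h2 h3
  rw [h1, h2, h3, hG, fourier_gaussian_innerProductSpace (by simpa using ha), norm_mul, norm_mul,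
    norm_character, one_mul, norm_mul, Complex.norm_exp, mul_assoc]
  congr 3
  have : -(π : ℂ) ^ 2 * (‖w‖ : ℂ) ^ 2 / (a : ℂ) = ((-(π ^ 2 / a) * ‖w‖ ^ 2 : ℝ) : ℂ) := by
    push_cast; ring
  rw [this, Complex.ofReal_re]

lemma integral_norm_sq_mul_l2Fourier_gaussian {f : Space N → ℝ} {k a : ℝ} {c : Space N}
    (ha : 0 < a) (hf : ∀ x, f x = k * rexp (-a * ‖x - c‖ ^ 2)) :
    ∫ w, ‖w‖ ^ 2 * ‖l2Fourier (fun x => (f x : ℂ)) w‖ ^ 2 =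
      N * a / (4 * π ^ 2) * ∫ w, ‖l2Fourier (fun x => (f x : ℂ)) w‖ ^ 2 := by
  obtain ⟨K, hK⟩ := exists_norm_l2Fourier_gaussian ha hf
  have key := integral_norm_sub_sq_mul_gaussian (N := N) (k := K) (a := π ^ 2 / a) (c := 0)
    (f := fun w => K * rexp (-(π ^ 2 / a) * ‖w‖ ^ 2)) (by positivity) (fun w => by simp)
  have e1 : ∫ w, ‖w‖ ^ 2 * ‖l2Fourier (fun x => (f x : ℂ)) w‖ ^ 2 =
      ∫ w : Space N, ‖w - 0‖ ^ 2 * (K * rexp (-(π ^ 2 / a) * ‖w‖ ^ 2)) ^ 2 :=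
    integral_congr_ae (hK.mono fun w hw => by simp only [hw, sub_zero])
  have e2 : ∫ w, ‖l2Fourier (fun x => (f x : ℂ)) w‖ ^ 2 =
      ∫ w : Space N, (K * rexp (-(π ^ 2 / a) * ‖w‖ ^ 2)) ^ 2 :=
    integral_congr_ae (hK.mono fun w hw => by simp only [hw])
  rw [e1, e2, key]
  congr 1
  field_simp

end GaussianMoments

/-! ### Reduction to a constant kernel -/

section ConstantKernel

variable {N : ℕ}

/-- A `v`-independent kernel which is invariant under time translation, reversal and scaling is
constant. -/
lemma IsUMITRSK.exists_const {φ : Space N → Space N → ℂ} (hφ : IsUMITRSK φ) :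
    ∃ c : ℂ, conj c * c = 1 ∧ φ = fun _ _ => c := by
  obtain ⟨ψ, hψ⟩ := hφ.invariant
  have hconst : ∀ v y, φ v y = φ 0 0 := fun v y => by
    -- With `t` fixed at `0`, the choice `z = y/2` reaches every `y`.
    have h1 := hψ v ((1 / 2 : ℝ) • y) 0
    have h2 := hψ 0 0 0
    simp only [sub_zero, smul_zero] at h1 h2
    rw [smul_smul, mul_one_div_cancel two_ne_zero, one_smul] at h1
    rw [h1, h2]
  refine ⟨φ 0 0, ?_, funext fun v => funext fun y => hconst v y⟩
  rw [Complex.conj_mul', hφ.unit_modulus]; simp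

/-- Equality at every point lets `f` be replaced by a strongly measurable representative. -/
lemma ambiguity_congr {f g : Space N → ℂ} (h : f =ᵐ[volume] g) (v y : Space N) :
    ambiguity f v y = ambiguity g v y := by
  refine Real.fourierInv_congr_ae ?_ v
  have h1 : (fun z => f (z + (1 / 2 : ℝ) • y)) =ᵐ[volume] fun z => g (z + (1 / 2 : ℝ) • y) :=
    (measurePreserving_add_right volume _).quasiMeasurePreserving.ae_eq h
  have h2 : (fun z => f (z - (1 / 2 : ℝ) • y)) =ᵐ[volume] fun z => g (z - (1 / 2 : ℝ) • y) :=
    (measurePreserving_sub_right volume _).quasiMeasurePreserving.ae_eq h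
  filter_upwards [h1, h2] with z hz1 hz2
  simp only [shiftedTensor, hz1, hz2]

lemma cctfd_congr {f g : Space N → ℂ} (h : f =ᵐ[volume] g) (φ : Space N → Space N → ℂ) :
    cctfd φ f = cctfd φ g := by
  simp only [cctfd, ambiguity_congr h]

lemma energy_congr {f g : Space N → ℂ} (h : f =ᵐ[volume] g) : energy f = energy g := by
  refine withDensity_congr_ae ?_
  filter_upwards [h] with x hx
  rw [hx]

lemma energy_real_univ_l2Fourier {f : Space N → ℂ} (hf : MemLp f 2) :
    (energy (l2Fourier f)).real Set.univ = (energy f).real Set.univ := by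
  rw [energy_real_univ hf, energy_real_univ (memLp_l2Fourier f)]
  have := integral_conj_l2Fourier_mul hf hf
  simp only [Complex.conj_mul'] at this
  exact_mod_cast this

/-- The spreads of Cohen's class distribution with a constant unimodular kernel are half the
normalised central moments of the function and of its Fourier transform. -/
lemma spreads_cctfd_const {f : Space N → ℂ} (hf : MemLp f 2)
    (hx : Integrable fun x => ‖x‖ ^ 2 * ‖f x‖ ^ 2)
    (hw : Integrable fun w => ‖w‖ ^ 2 * ‖l2Fourier f w‖ ^ 2)
    (h0 : (energy f).real Set.univ ≠ 0) {c : ℂ} (hc : conj c * c = 1) :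
    timeSpreadTF (cctfd (fun _ _ => c) f) =
        centralMoment (energy f) / (2 * (energy f).real Set.univ) ∧
      freqSpreadTF (cctfd (fun _ _ => c) f) =
        centralMoment (energy (l2Fourier f)) / (2 * (energy f).real Set.univ) := by
  obtain ⟨g, hgm, hfg⟩ := hf.1
  have hg : MemLp g 2 := hf.ae_eq hfg
  have := isFiniteMeasure_energy hf
  have := isFiniteMeasure_energy (memLp_l2Fourier f)
  have hfst := map_fst_energy_cctfd hgm hg hc
  have hsnd := map_snd_energy_cctfd hgm hg hc
  rw [← cctfd_congr hfg, ← energy_congr hfg] at hfst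
  rw [← cctfd_congr hfg, ← l2Fourier_congr hfg] at hsnd
  refine ⟨spread_of_map_energy_eq (memLp_cctfd _ f) (by fun_prop) (memLp_id_energy hf hx) h0 hfst,
    ?_⟩
  rw [← energy_real_univ_l2Fourier hf] at h0 ⊢
  exact spread_of_map_energy_eq (memLp_cctfd _ f) (by fun_prop)
    (memLp_id_energy (memLp_l2Fourier f) hw) h0 hsnd

end ConstantKernel

/-! ### Real-valued functions -/

section RealFunctions

open Real Filter Topology
open scoped RealInnerProductSpace

variable {N : ℕ} {f : Space N → ℝ}

lemma memLp_ofReal (hf : MemLp f 2) : MemLp (fun x => (f x : ℂ)) 2 := hf.ofReal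

lemma norm_sq_ofReal (f : Space N → ℝ) (x : Space N) : ‖(f x : ℂ)‖ ^ 2 = f x ^ 2 := by simp

/-- The energy of the Fourier transform of a real-valued function is even. -/
lemma map_neg_energy_l2Fourier_ofReal (hf : MemLp f 2) :
    (energy (l2Fourier fun x => (f x : ℂ))).map (fun w => -w) =
      energy (l2Fourier fun x => (f x : ℂ)) := by
  have := isFiniteMeasure_energy (memLp_l2Fourier fun x => (f x : ℂ))
  refine Measure.ext_of_charFun (funext fun t => ?_)
  have h1 : charFun ((energy (l2Fourier fun x => (f x : ℂ))).map fun w => -w) t =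
      charFun (energy (l2Fourier fun x => (f x : ℂ))) (-t) := by
    rw [charFun_apply, charFun_apply, integral_map (by fun_prop) (by fun_prop)]
    simp
  -- Reflection conjugates the characteristic function, which is real here as the autocorrelation of
  -- a real function.
  rw [h1, charFun_neg, charFun_energy_l2Fourier (memLp_ofReal hf), ← integral_conj]
  simp

lemma barycentre_energy_l2Fourier_ofReal (hf : MemLp f 2) :
    barycentre (energy (l2Fourier fun x => (f x : ℂ))) = 0 := by
  have h := map_neg_energy_l2Fourier_ofReal hf
  have h1 : ∫ w, w ∂(energy (l2Fourier fun x => (f x : ℂ))) =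
      -∫ w, w ∂(energy (l2Fourier fun x => (f x : ℂ))) := by
    conv_lhs => rw [← h]
    rw [integral_map (by fun_prop) (by fun_prop), integral_neg]
  have h2 := add_eq_zero_iff_eq_neg.2 h1
  rw [← two_smul ℝ, smul_eq_zero_iff_right two_ne_zero] at h2
  rw [barycentre, h2, smul_zero]

lemma centralMoment_energy_l2Fourier_ofReal (hf : MemLp f 2) :
    centralMoment (energy (l2Fourier fun x => (f x : ℂ))) =
      ∫ w, ‖w‖ ^ 2 * ‖l2Fourier (fun x => (f x : ℂ)) w‖ ^ 2 := by
  rw [centralMoment, barycentre_energy_l2Fourier_ofReal hf, integral_energy (memLp_l2Fourier _)]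
  simp [mul_comm]

lemma energy_ofReal_real_univ (hf : MemLp f 2) :
    (energy fun x => (f x : ℂ)).real Set.univ = ∫ x, f x ^ 2 := by
  rw [energy_real_univ (memLp_ofReal hf)]
  simp only [norm_sq_ofReal]

lemma barycentre_energy_ofReal (hf : MemLp f 2) :
    barycentre (energy fun x => (f x : ℂ)) = timeMoment f := by
  rw [barycentre, energy_ofReal_real_univ hf, integral_energy (memLp_ofReal hf), timeMoment]
  simp only [norm_sq_ofReal]

lemma centralMoment_energy_ofReal (hf : MemLp f 2) :
    centralMoment (energy fun x => (f x : ℂ)) = ∫ x, ‖x - timeMoment f‖ ^ 2 * f x ^ 2 := by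
  rw [centralMoment, barycentre_energy_ofReal hf, integral_energy (memLp_ofReal hf)]
  simp only [norm_sq_ofReal, smul_eq_mul, mul_comm]

lemma norm_character_sub_one_le {V : Type*} [NormedAddCommGroup V] [InnerProductSpace ℝ V]
    (h w : V) : ‖character h w - 1‖ ≤ |2 * π * ⟪h, w⟫| := by
  rw [character, mul_comm _ Complex.I]
  exact Real.norm_exp_I_mul_ofReal_sub_one_le

lemma l2Fourier_comp_add_sub {V : Type*} [NormedAddCommGroup V] [InnerProductSpace ℝ V]
    [FiniteDimensional ℝ V] [MeasurableSpace V] [BorelSpace V] {f : V → ℂ} (hf : MemLp f 2)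
    (h : V) : l2Fourier (fun x => f (x + h) - f x) =ᵐ[volume]
      fun w => (character h w - 1) * l2Fourier f w := by
  have hh := memLp_comp_add hf h
  have hd : MemLp (fun x => f (x + h) - f x) 2 := hh.sub hf
  have h1 : l2Fourier (fun x => f (x + h) - f x) =ᵐ[volume]
      fun w => l2Fourier (fun x => f (x + h)) w - l2Fourier f w := by
    rw [l2Fourier_of_memLp hd, l2Fourier_of_memLp hh, l2Fourier_of_memLp hf]
    have e : (hd.toLp _ : Lp (α := V) ℂ 2) = hh.toLp _ - hf.toLp _ := MemLp.toLp_sub hh hf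
    rw [e]
    have e2 : (𝓕 (hh.toLp _ - hf.toLp _ : Lp (α := V) ℂ 2) : Lp (α := V) ℂ 2) =
        𝓕 (hh.toLp _ : Lp (α := V) ℂ 2) - 𝓕 (hf.toLp _ : Lp (α := V) ℂ 2) :=
      map_sub (Lp.fourierTransformₗᵢ V ℂ) _ _
    rw [e2]
    exact Lp.coeFn_sub _ _
  filter_upwards [h1, l2Fourier_comp_add hf h] with w a1 a2
  rw [a1, a2]; ring

lemma integral_norm_sq_l2Fourier {V : Type*} [NormedAddCommGroup V] [InnerProductSpace ℝ V]
    [FiniteDimensional ℝ V] [MeasurableSpace V] [BorelSpace V] {f : V → ℂ} (hf : MemLp f 2) :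
    ∫ w, ‖l2Fourier f w‖ ^ 2 = ∫ x, ‖f x‖ ^ 2 := by
  have := integral_conj_l2Fourier_mul hf hf
  simp only [Complex.conj_mul'] at this
  exact_mod_cast this

lemma integrable_coord_sq_mul {g : Space N → ℂ} (hg : AEStronglyMeasurable g)
    (hw : Integrable fun w => ‖w‖ ^ 2 * ‖g w‖ ^ 2) (i : Fin N) :
    Integrable fun w : Space N => w i ^ 2 * ‖g w‖ ^ 2 := by
  refine hw.mono ?_ (ae_of_all _ fun w => ?_)
  · exact (by fun_prop : Continuous fun w : Space N => w i ^ 2).aestronglyMeasurable.mul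
      (hg.norm.pow 2)
  · rw [norm_mul, norm_mul, norm_pow, norm_pow ‖w‖, norm_norm]
    gcongr
    exact PiLp.norm_apply_le w i

/-- Translation differences are controlled by the frequency moments. -/
lemma integral_translation_difference_sq_le (hf : MemLp f 2)
    (hw : Integrable fun w => ‖w‖ ^ 2 * ‖l2Fourier (fun x => (f x : ℂ)) w‖ ^ 2) (i : Fin N)
    (t : ℝ) :
    ∫ x, (f (x + t • basisVec i) - f x) ^ 2 ≤
      4 * π ^ 2 * t ^ 2 * ∫ w, w i ^ 2 * ‖l2Fourier (fun x => (f x : ℂ)) w‖ ^ 2 := by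
  have hfc := memLp_ofReal hf
  have hd : MemLp (fun x => (f (x + t • basisVec i) : ℂ) - f x) 2 :=
    (memLp_comp_add hfc (t • basisVec i)).sub hfc
  have hi := integrable_coord_sq_mul (memLp_l2Fourier fun x => (f x : ℂ)).1 hw i
  calc ∫ x, (f (x + t • basisVec i) - f x) ^ 2
      = ∫ x, ‖(f (x + t • basisVec i) : ℂ) - f x‖ ^ 2 := by
        refine integral_congr_ae (ae_of_all _ fun x => ?_)
        simp only [← Complex.ofReal_sub, Complex.norm_real, Real.norm_eq_abs, sq_abs]
    _ = ∫ w, ‖l2Fourier (fun x => (f (x + t • basisVec i) : ℂ) - f x) w‖ ^ 2 :=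
        (integral_norm_sq_l2Fourier hd).symm
    _ ≤ ∫ w, 4 * π ^ 2 * t ^ 2 * (w i ^ 2 * ‖l2Fourier (fun x => (f x : ℂ)) w‖ ^ 2) := by
        refine integral_mono_ae ((memLp_l2Fourier _).integrable_norm_pow (by norm_num))
          (hi.const_mul _) ?_
        filter_upwards [l2Fourier_comp_add_sub hfc (t • basisVec i)] with w h1
        rw [h1, norm_mul, mul_pow, ← mul_assoc]
        refine mul_le_mul_of_nonneg_right ?_ (sq_nonneg _)
        have h2 := norm_character_sub_one_le (t • basisVec i) w
        have h3 : ⟪t • basisVec i, w⟫ = t * w i := by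
          rw [real_inner_smul_left, EuclideanSpace.inner_single_left]; simp
        rw [h3] at h2
        calc _ ≤ |2 * π * (t * w i)| ^ 2 := pow_le_pow_left₀ (norm_nonneg _) h2 2
          _ = _ := by rw [sq_abs]; ring
    _ = _ := integral_const_mul _ _

lemma sum_integral_coord_sq_mul {g : Space N → ℂ} (hg : AEStronglyMeasurable g)
    (hw : Integrable fun w => ‖w‖ ^ 2 * ‖g w‖ ^ 2) :
    ∑ i, ∫ w, w i ^ 2 * ‖g w‖ ^ 2 = ∫ w, ‖w‖ ^ 2 * ‖g w‖ ^ 2 := by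
  rw [← integral_finsetSum _ fun i _ => integrable_coord_sq_mul hg hw i]
  simp only [← Finset.sum_mul, EuclideanSpace.norm_sq_eq, Real.norm_eq_abs, sq_abs]

lemma IsOptimalGaussian.exists_eq (h : IsOptimalGaussian f ∨ IsOptimalGaussian fun x => -f x) :
    ∃ a k : ℝ, 0 < a ∧ ∀ x, f x = k * rexp (-a * ‖x - timeMoment f‖ ^ 2) := by
  rcases h with ⟨ζ, ε, hζ, h⟩ | ⟨ζ, ε, hζ, h⟩
  · refine ⟨1 / (2 * ζ), rexp ε, by positivity, fun x => ?_⟩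
    rw [h x, Real.exp_add, mul_comm]
  · have hm : timeMoment (fun x => -f x) = timeMoment f := by simp [timeMoment]
    refine ⟨1 / (2 * ζ), -rexp ε, by positivity, fun x => ?_⟩
    have hx : -f x = _ := h x
    rw [← neg_neg (f x), hx, hm, Real.exp_add]; ring

lemma isOptimalGaussian_of_eq {a k : ℝ} (ha : 0 < a) (hk : k ≠ 0)
    (h : ∀ x, f x = k * rexp (-a * ‖x - timeMoment f‖ ^ 2)) :
    IsOptimalGaussian f ∨ IsOptimalGaussian fun x => -f x := by
  have hm : timeMoment (fun x => -f x) = timeMoment f := by simp [timeMoment]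
  -- The parameters are `ζ = 1/(2a)` and `ε = log |k|`; the sign of `k` decides between `f` and
  -- `-f`.
  have hζ : 1 / (2 * (1 / (2 * a))) = a := by field_simp
  rcases lt_or_gt_of_ne hk with hneg | hpos
  · refine Or.inr ⟨1 / (2 * a), log (-k), by positivity, fun x => ?_⟩
    rw [hm, hζ, Real.exp_add, Real.exp_log (by linarith)]
    change -f x = _
    rw [h x]; ring
  · refine Or.inl ⟨1 / (2 * a), log k, by positivity, fun x => ?_⟩
    rw [hζ, Real.exp_add, Real.exp_log hpos, mul_comm]
    exact h x

/-- A function with partial derivatives everywhere which is almost everywhere equal to a Gaussian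
is a Gaussian. -/
lemma eq_gaussian_of_ae_eq
    (hgrad : ∀ (x : Space N) (i : Fin N), LineDifferentiableAt ℝ f x (basisVec i)) {k b : ℝ}
    {c : Space N} (h : f =ᵐ[volume] fun x => k * rexp (b * ‖x - c‖ ^ 2)) (x : Space N) :
    f x = k * rexp (b * ‖x - c‖ ^ 2) := by
  refine sub_eq_zero.1 (eq_zero_of_ae_eq_zero_of_line_continuous
    (h := fun x => f x - k * rexp (b * ‖x - c‖ ^ 2)) (fun y i => ?_) ?_ x)
  · have h1 := line_continuous_of_lineDifferentiableAt (fun x => hgrad x i) y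
    exact h1.sub (by fun_prop)
  · filter_upwards [h] with y hy
    rw [hy]; simp

end RealFunctions

end CohenClass

/-! ### The bound and the equality case -/

open CohenClass

theorem theorem1 {N : ℕ} (f : CohenClass.Space N → ℝ)
    (φ : CohenClass.Space N → CohenClass.Space N → ℂ)
    (hφ : CohenClass.IsUMITRSK φ)
    (hφ_sign : ∀ v y, φ v y = 1 ∨ φ v y = -1)
    (hf : MemLp f 2 volume)
    (hxf : MemLp (fun x => ‖x‖ * f x) 2 volume)
    (hwf : MemLp (fun w => (‖w‖ : ℂ) * CohenClass.l2Fourier (fun x => (f x : ℂ)) w) 2 volume)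
    (hf_ne : ¬ f =ᵐ[volume] 0)
    (hgrad : ∀ (x : CohenClass.Space N) (i : Fin N),
      LineDifferentiableAt ℝ f x (EuclideanSpace.single i 1)) :
    CohenClass.realBound N / 4 ≤
        CohenClass.timeSpreadTF (CohenClass.cctfd φ (fun x => (f x : ℂ))) *
          CohenClass.freqSpreadTF (CohenClass.cctfd φ (fun x => (f x : ℂ))) ∧
      ((∀ᵐ x, f x ≠ 0) →
        (CohenClass.timeSpreadTF (CohenClass.cctfd φ (fun x => (f x : ℂ))) *
            CohenClass.freqSpreadTF (CohenClass.cctfd φ (fun x => (f x : ℂ))) =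
              CohenClass.realBound N / 4 ↔
          CohenClass.IsOptimalGaussian f ∨ CohenClass.IsOptimalGaussian (fun x => -f x))) := by
  obtain ⟨s, hs, rfl⟩ := hφ.exists_const
  have hfc := memLp_ofReal hf
  have hx : Integrable fun x => ‖x‖ ^ 2 * ‖(f x : ℂ)‖ ^ 2 :=
    hxf.integrable_sq.congr (ae_of_all _ fun x => by simp [mul_pow])
  have hw : Integrable fun w => ‖w‖ ^ 2 * ‖l2Fourier (fun x => (f x : ℂ)) w‖ ^ 2 :=
    (hwf.integrable_norm_pow (p := 2) (by norm_num)).congr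
      (ae_of_all _ fun x => by simp [mul_pow])
  set m := ∫ x, f x ^ 2 with hm
  set X := ∫ x, ‖x - timeMoment f‖ ^ 2 * f x ^ 2 with hX
  set W := ∫ w, ‖w‖ ^ 2 * ‖l2Fourier (fun x => (f x : ℂ)) w‖ ^ 2 with hWdef
  have hm0 : 0 < m := by
    refine lt_of_le_of_ne (integral_nonneg fun x => sq_nonneg _) fun h => hf_ne ?_
    have := (integral_eq_zero_iff_of_nonneg (fun x => sq_nonneg (f x)) hf.integrable_sq).1 h.symm
    filter_upwards [this] with x hx
    simpa using hx
  have hmass : (energy fun x => (f x : ℂ)).real Set.univ = m := energy_ofReal_real_univ hf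
  obtain ⟨hT, hF⟩ := spreads_cctfd_const hfc hx hw (by rw [hmass]; exact hm0.ne') hs
  rw [hT, hF, hmass, centralMoment_energy_ofReal hf, centralMoment_energy_l2Fourier_ofReal hf,
    ← hX, ← hWdef]
  have hform : ∀ lam : ℝ, uncertaintyForm f (timeMoment f)
      (∑ i, ∫ w, w i ^ 2 * ‖l2Fourier (fun x => (f x : ℂ)) w‖ ^ 2) lam =
        4 * Real.pi ^ 2 * W - lam * N * m + lam ^ 2 * X := fun lam => by
    rw [uncertaintyForm, sum_integral_coord_sq_mul (memLp_l2Fourier _).1 hw]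
  have hdiff := integral_translation_difference_sq_le hf hw
  have hpi := Real.pi_pos
  have hineq : ((N : ℝ) * m) ^ 2 ≤ 16 * Real.pi ^ 2 * (X * W) := by
    -- A quadratic nonnegative for every `λ` has nonpositive discriminant: this is Heisenberg's
    -- inequality.
    have hd := discrim_le_zero (a := X) (b := -(N * m)) (c := 4 * Real.pi ^ 2 * W) fun lam => by
      have := uncertaintyForm_nonneg (c := timeMoment f) hf hxf hdiff lam
      rw [hform] at this
      linarith
    rw [discrim] at hd
    linarith
  have hprod : X / (2 * m) * (W / (2 * m)) = X * W / (4 * m ^ 2) := by field_simp; ring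
  have hbound : realBound N / 4 = ((N : ℝ) * m) ^ 2 / (16 * Real.pi ^ 2) / (4 * m ^ 2) := by
    rw [realBound]; field_simp
  rw [hprod, hbound]
  refine ⟨?_, fun _ => ⟨fun heq => ?_, fun hG => ?_⟩⟩
  · gcongr
    rw [div_le_iff₀ (by positivity)]
    linarith
  · have heq' : ((N : ℝ) * m) ^ 2 = 16 * Real.pi ^ 2 * (X * W) := by
      field_simp at heq
      linarith
    -- Equality makes the discriminant vanish, so for `N > 0` the double root is `Nm/(2X)`. For `N =
    -- 0` both `X` and `W` vanish and any `λ` works.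
    obtain ⟨lam, hlam, hzero⟩ : ∃ lam : ℝ, 0 < lam ∧
        4 * Real.pi ^ 2 * W - lam * N * m + lam ^ 2 * X = 0 := by
      rcases Nat.eq_zero_or_pos N with rfl | hN
      · have hnorm : ∀ x : Space 0, ‖x‖ = 0 := fun x => by
          rw [Subsingleton.elim x 0, norm_zero]
        refine ⟨1, one_pos, ?_⟩
        simp [hWdef, hX, hnorm]
      · have hN' : (0 : ℝ) < N := by exact_mod_cast hN
        have hXn : 0 ≤ X := integral_nonneg fun x => by positivity
        have hX0 : X ≠ 0 := fun h => by
          rw [h, zero_mul, mul_zero] at heq'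
          have : (0 : ℝ) < (N * m) ^ 2 := by positivity
          linarith
        have hXpos : 0 < X := lt_of_le_of_ne hXn (Ne.symm hX0)
        refine ⟨N * m / (2 * X), by positivity, ?_⟩
        field_simp
        linarith
    rw [← hform] at hzero
    obtain ⟨k, hk⟩ := exists_ae_eq_gaussian hf hxf hdiff hzero
    refine isOptimalGaussian_of_eq (half_pos hlam) (fun hk0 => hf_ne ?_)
      (eq_gaussian_of_ae_eq hgrad hk)
    filter_upwards [hk] with x hx
    rw [hx, hk0, zero_mul]; rfl
  · obtain ⟨a, k, ha, hfa⟩ := IsOptimalGaussian.exists_eq hG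
    -- The rate `a` cancels between the two moments, so every Gaussian attains the bound.
    have hXa : X = N / (4 * a) * m := integral_norm_sub_sq_mul_gaussian ha hfa
    have hWa : W = N * a / (4 * Real.pi ^ 2) * m := by
      rw [hWdef, integral_norm_sq_mul_l2Fourier_gaussian ha hfa, integral_norm_sq_l2Fourier hfc]
      simp only [norm_sq_ofReal, hm]
    rw [hXa, hWa]
    field_simp
    norm_num
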